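/- Let $J_\mu$ and $K_\mu$ denote the Bessel function of the first kind and the modified Bessel (Macdonald) function, $K_\mu(z)=\int_0^\infty e^{-z\cosh u}\cosh(\mu u)\,du$ for $\operatorname{Re} z>0$. Let $L^0=L_1(\mathbb{R}_+;K_0^2(\sqrt{2x})\,dx)$ be the space of (classes of) measurable functions $f:\mathbb{R}_+\to\mathbb{C}$ with norm $\|f\|_{L^0}=\int_0^\infty K_0^2(\sqrt{2x})\,|f(x)|\,dx<\infty$, and let $C_0(\mathbb{R})$ be the space of continuous functions $\mathbb{R}\to\mathbb{C}$ vanishing at infinity, with the supremum norm. Consider the index transform $$(Ff)(\tau)=\frac{1}{\sinh(\pi\tau/2)}\int_0^\infty K_{i\tau}(2\sqrt{2x})\,\operatorname{Im}\left[J_{i\tau}(2\sqrt{2x})\right]f(x)\,dx,\qquad \tau\in\mathbb{R}\setminus\{0\}.$$ Theorem 1. For every $f\in L^0$ the integral defining $(Ff)(\tau)$ converges absolutely for every $\tau\neq 0$, $Ff$ extends (uniquely) to a function in $C_0(\mathbb{R})$, and $F$ is a bounded linear operator from $L^0$ into $C_0(\mathbb{R})$ with norm at most $4/\pi$. Moreover,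 define $$(\mathcal{K}_0f)(x)=-\sqrt{\frac{2}{\pi}}\int_0^\infty \operatorname{Re}\left[K_0\left(4e^{\pi i/4}\sqrt{xt}\right)\right]f(t)\,dt .$$ Then for every $f\in L^0$ the integral defining $(\mathcal{K}_0f)(x)$ converges absolutely for every $x>1$, the function $t\mapsto(\mathcal{K}_0f)(\cosh t)$ is integrable on $(0,\infty)$, and for every $\tau\in\mathbb{R}$ $$(Ff)(\tau)=\sqrt{\frac{2}{\pi}}\int_0^\infty(\mathcal{K}_0f)(\cosh t)\cos(\tau t)\,dt,$$ that is, $Ff$ is the Fourier cosine transform of $t\mapsto(\mathcal{K}_0f)(\cosh t)$ (with the value at $\tau=0$ that of the continuous extension). -/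

import Mathlib

open MeasureTheory Set
open scoped ZeroAtInfty

noncomputable section

/-- The Bessel function `J_μ(z)` of the first kind, by its power series, for complex order `μ`
(principal branch of the power; entire reciprocal Gamma function: Mathlib's `Γ` vanishes at its
poles, so that `1 / Γ` is `0` there, as it should be). -/
def besselJ (μ z : ℂ) : ℂ :=
  (z / 2) ^ μ *
    ∑' k : ℕ, (-1) ^ k / ((k.factorial : ℂ) * Complex.Gamma (μ + k + 1)) * (z / 2) ^ (2 * k)

/-- The modified Bessel (Macdonald) function `K_μ(z)` of complex order `μ`, on the half-plane
`Re z > 0`, by `K_μ(z) = ∫_0^∞ exp (-z cosh u) cosh (μ u) du`. -/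
def besselK (μ z : ℂ) : ℂ :=
  ∫ u in Ioi (0 : ℝ), Complex.exp (-z * (Real.cosh u : ℂ)) * Complex.cosh (μ * u)

/-- The kernel `K_{iτ}(2√(2x)) Im[J_{iτ}(2√(2x))] / sinh(πτ/2)`, meant for `x > 0`, `τ ≠ 0`. -/
def indexKernel (τ x : ℝ) : ℂ :=
  besselK (Complex.I * τ) ((2 * √(2 * x) : ℝ) : ℂ) *
      ((besselJ (Complex.I * τ) ((2 * √(2 * x) : ℝ) : ℂ)).im : ℂ) /
    (Real.sinh (Real.pi * τ / 2) : ℂ)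

/-- The index transform `F`, meant for `τ ≠ 0`. -/
def indexTransform (f : ℝ → ℂ) (τ : ℝ) : ℂ :=
  ∫ x in Ioi (0 : ℝ), indexKernel τ x * f x

/-- The Fourier cosine transform `F_c`. -/
def fourierCosine (g : ℝ → ℂ) (x : ℝ) : ℂ :=
  (√(2 / Real.pi) : ℂ) * ∫ t in Ioi (0 : ℝ), g t * (Real.cos (x * t) : ℂ)

/-- `Re K_0(4 e^{πi/4} √(x t))`, for `x, t > 0`. -/
def meijerKernel (x t : ℝ) : ℝ :=
  (besselK 0 (4 * Complex.exp (Real.pi * Complex.I / 4) * (√(x * t) : ℂ))).re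

/-- The operator `𝒦₀` of the Meijer type K-transform. -/
def meijerTransform (f : ℝ → ℂ) (x : ℝ) : ℂ :=
  -(√(2 / Real.pi) : ℂ) * ∫ t in Ioi (0 : ℝ), (meijerKernel x t : ℂ) * f t

/-- The measure `K_0(√(2x))² dx` on the half-line `(0, ∞)` (`K_0` is real there). -/
def weightMeasure : Measure ℝ :=
  (volume.restrict (Ioi (0 : ℝ))).withDensity
    fun x => ENNReal.ofReal ((besselK 0 (√(2 * x) : ℂ)).re ^ 2)

/-- The weighted space `L⁰ = L₁(ℝ₊; K_0²(√(2x)) dx)` of (classes of) complex functions, with its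
norm `‖f‖ = ∫_0^∞ K_0²(√(2x)) |f(x)| dx`. -/
abbrev WeightedL1 : Type := Lp ℂ 1 weightMeasure

end

open Filter Topology

/-! The kernel of `F` is itself a cosine transform. With `y = 2√(2x)`, it equals `-(2/π) ∫_0^∞ Re
K_0(4 e^{πi/4} √(x cosh w)) cos(τw) dw` (`indexKernel_eq_integral`). Everything else is Fubini and
the Riemann–Lebesgue lemma.

The identity comes from Macdonald's product formula `2 K_ν(X) K_ν(Y) = ∫_ℝ e^{νw} K_0(√(X² + Y² +
2XY cosh w)) dw` (`macdonald_mul_macdonald`), which says that the integral of a convolution is the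
product of the integrals. Take `X = y` and `Y = ε + iy` and let `ε → 0+`: the squares cancel and
only `2iy² cosh w` remains under the root (`macdonald_mul_macdonaldImag`). The boundary value
`K_ν(iy)` is read off the connection formula `K_ν = π / (2 sin πν) · (I_{-ν} - I_ν)`
(`macdonald_eq_besselSeries`), proved by uniqueness for the Bessel equation with data at the origin.
For `ν = iτ` the factor `K_{iτ}(y)` is real and `Re K_{iτ}(iy)` is `-(π/2) Im J_{iτ}(y) /
sinh(πτ/2)` (`re_macdonaldImag`), so real parts give the kernel.

The weight comes from the same formula. Since `Re √(2i) = 1`, the Meijer kernel is at most `K_0(y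
√cosh w)`. As `cosh w ≥ (1 + cosh w)/2`, the integral of this bound over `w > 0` is at most
`K_0(y/2)² = K_0(√(2x))²`, by the product formula with `ν = 0` and `X = Y = y/2`
(`integrable_macdonaldReal_mul_sqrt_cosh`). -/

/-! ### Laplace type integrals in `cosh u` -/

theorem one_add_sq_half_le_cosh (u : ℝ) : 1 + u ^ 2 / 2 ≤ Real.cosh u := by
  have h1 : Real.cosh u = 1 + 2 * Real.sinh (u / 2) ^ 2 := by
    have h := Real.cosh_two_mul (u / 2)
    have h2 := Real.cosh_sq (u / 2)
    rw [show 2 * (u / 2) = u by ring] at h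
    rw [h, h2]; ring
  have h3 : (u / 2) ^ 2 ≤ Real.sinh (u / 2) ^ 2 := by
    rw [sq_le_sq, Real.abs_sinh]
    exact Real.self_le_sinh_iff.2 (abs_nonneg _)
  rw [h1]; nlinarith

theorem cosh_le_exp_abs (u : ℝ) : Real.cosh u ≤ Real.exp |u| := by
  rw [← Real.cosh_abs, Real.cosh_eq]
  have : Real.exp (-|u|) ≤ Real.exp |u| := Real.exp_le_exp.2 (by linarith [abs_nonneg u])
  linarith

/-- Comparison with a Gaussian: `cosh u` supplies `-r u²/2`, and completing the square in `m|u|`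
costs only `r u²/4` and the constant `m²/r`. -/
theorem integrable_exp_neg_mul_cosh_add (r m : ℝ) (hr : 0 < r) :
    Integrable fun u : ℝ => Real.exp (-r * Real.cosh u + m * |u|) := by
  refine ((integrable_exp_neg_mul_sq (b := r / 4) (by positivity)).const_mul
    (Real.exp (m ^ 2 / r))).mono' (by fun_prop) (Eventually.of_forall fun u => ?_)
  rw [Real.norm_eq_abs, Real.abs_exp, ← Real.exp_add]
  apply Real.exp_le_exp.2
  have h1 : -r * Real.cosh u ≤ -r * (1 + u ^ 2 / 2) :=
    mul_le_mul_of_nonpos_left (one_add_sq_half_le_cosh u) (by linarith)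
  have h2 : m * |u| ≤ m ^ 2 / r + r / 4 * u ^ 2 := by
    have : 0 ≤ r⁻¹ * (m - r / 2 * |u|) ^ 2 := by positivity
    have h3 : r⁻¹ * (m - r / 2 * |u|) ^ 2 = m ^ 2 / r + r / 4 * |u| ^ 2 - m * |u| := by
      field_simp
      ring
    rw [sq_abs] at h3
    linarith
  nlinarith

theorem norm_exp_neg_mul_cosh (z : ℂ) (u : ℝ) :
    ‖Complex.exp (-z * (Real.cosh u : ℂ))‖ = Real.exp (-z.re * Real.cosh u) := by
  rw [Complex.norm_exp]
  simp

theorem norm_exp_ofReal_mul_le (μ : ℂ) (u : ℝ) :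
    ‖Complex.exp (μ * u)‖ ≤ 1 * Real.exp (‖μ‖ * |u|) := by
  rw [Complex.norm_exp, one_mul]
  apply Real.exp_le_exp.2
  refine (Complex.re_le_norm _).trans ?_
  simp

/-- The Laplace type transform `∫ exp (-z cosh u) φ(u) du` over the real line. -/
noncomputable def coshTransform (φ : ℝ → ℂ) (z : ℂ) : ℂ :=
  ∫ u : ℝ, Complex.exp (-z * (Real.cosh u : ℂ)) * φ u

theorem integrable_coshTransform {φ : ℝ → ℂ} (hφ : Continuous φ) {C m : ℝ}
    (hb : ∀ u, ‖φ u‖ ≤ C * Real.exp (m * |u|)) {z : ℂ} (hz : 0 < z.re) :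
    Integrable fun u : ℝ => Complex.exp (-z * (Real.cosh u : ℂ)) * φ u := by
  refine ((integrable_exp_neg_mul_cosh_add z.re m hz).const_mul C).mono' ?_
    (Eventually.of_forall fun u => ?_)
  · exact (by fun_prop : Continuous _).aestronglyMeasurable
  · rw [norm_mul, norm_exp_neg_mul_cosh, Real.exp_add]
    have := mul_le_mul_of_nonneg_left (hb u) (Real.exp_nonneg (-z.re * Real.cosh u))
    linarith

theorem norm_cosh_mul_le {φ : ℝ → ℂ} {C m : ℝ}
    (hb : ∀ u, ‖φ u‖ ≤ C * Real.exp (m * |u|)) (u : ℝ) :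
    ‖(Real.cosh u : ℂ) * φ u‖ ≤ C * Real.exp ((m + 1) * |u|) := by
  rw [norm_mul, Complex.norm_real, Real.norm_eq_abs, abs_of_pos (Real.cosh_pos u), add_mul, Real.exp_add, one_mul]
  calc Real.cosh u * ‖φ u‖ ≤ Real.exp |u| * (C * Real.exp (m * |u|)) :=
        mul_le_mul (cosh_le_exp_abs u) (hb u) (norm_nonneg _) (Real.exp_nonneg _)
    _ = _ := by ring

/-- A general density `φ` is allowed because two are needed: `exp (μ u)` for the Macdonald function,
and `exp (-X cosh (w - u))` for the continuation of the product formula in `Y`. -/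
theorem hasDerivAt_coshTransform {φ : ℝ → ℂ} (hφ : Continuous φ) {C m : ℝ}
    (hb : ∀ u, ‖φ u‖ ≤ C * Real.exp (m * |u|)) {z : ℂ} (hz : 0 < z.re) :
    HasDerivAt (coshTransform φ) (-coshTransform (fun u => (Real.cosh u : ℂ) * φ u) z) z := by
  have hb' := norm_cosh_mul_le hb
  have hs : {w : ℂ | z.re / 2 < w.re} ∈ 𝓝 z :=
    (isOpen_lt continuous_const Complex.continuous_re).mem_nhds (by simp only [mem_ofPred_eq]; linarith)
  have key := (hasDerivAt_integral_of_dominated_loc_of_deriv_le (μ := volume) (𝕜 := ℂ)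
    (F := fun w (u : ℝ) => Complex.exp (-w * (Real.cosh u : ℂ)) * φ u)
    (F' := fun w (u : ℝ) => -(Complex.exp (-w * (Real.cosh u : ℂ)) * ((Real.cosh u : ℂ) * φ u)))
    (bound := fun u => C * Real.exp (-(z.re / 2) * Real.cosh u + (m + 1) * |u|)) hs
    (Eventually.of_forall fun w => (by fun_prop : Continuous _).aestronglyMeasurable)
    (integrable_coshTransform hφ hb hz)
    ((by fun_prop : Continuous _).aestronglyMeasurable)
    (Eventually.of_forall fun u w hw => ?_)
    ((integrable_exp_neg_mul_cosh_add _ _ (by linarith)).const_mul C)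
    (Eventually.of_forall fun u w _ => ?_)).2
  · rw [integral_neg] at key
    exact key
  · rw [norm_neg, norm_mul, norm_exp_neg_mul_cosh, Real.exp_add]
    have h1 : Real.exp (-w.re * Real.cosh u) ≤ Real.exp (-(z.re / 2) * Real.cosh u) := by
      apply Real.exp_le_exp.2
      have : z.re / 2 < w.re := hw
      nlinarith [Real.cosh_pos u]
    calc _ ≤ Real.exp (-(z.re / 2) * Real.cosh u) * (C * Real.exp ((m + 1) * |u|)) :=
          mul_le_mul h1 (hb' u) (norm_nonneg _) (Real.exp_nonneg _)
      _ = _ := by ring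
  · have h : HasDerivAt (fun w : ℂ => Complex.exp (-w * (Real.cosh u : ℂ)) * φ u)
        (Complex.exp (-w * (Real.cosh u : ℂ)) * (-1 * (Real.cosh u : ℂ)) * φ u) w :=
      (((hasDerivAt_id w).neg.mul_const _).cexp).mul_const _
    exact h.congr_deriv (by ring)

theorem differentiableOn_coshTransform {φ : ℝ → ℂ} (hφ : Continuous φ) {C m : ℝ}
    (hb : ∀ u, ‖φ u‖ ≤ C * Real.exp (m * |u|)) :
    DifferentiableOn ℂ (coshTransform φ) {z | 0 < z.re} := fun _ hz =>
  (hasDerivAt_coshTransform hφ hb hz).differentiableAt.differentiableWithinAt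

/-! ### The Macdonald function on the right half-plane -/

/-- The Macdonald function by its integral over the whole line. -/
noncomputable def macdonald (μ z : ℂ) : ℂ :=
  coshTransform (fun u => Complex.exp (μ * u)) z / 2

theorem macdonald_neg (μ z : ℂ) : macdonald (-μ) z = macdonald μ z := by
  unfold macdonald coshTransform
  congr 1
  rw [← integral_neg_eq_self]
  simp

theorem integrable_macdonald (μ : ℂ) {z : ℂ} (hz : 0 < z.re) :
    Integrable fun u : ℝ => Complex.exp (-z * (Real.cosh u : ℂ)) * Complex.exp (μ * u) :=
  integrable_coshTransform (by fun_prop) (norm_exp_ofReal_mul_le μ) hz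

theorem integral_eq_two_mul_integral_Ioi {E : Type*} [NormedAddCommGroup E] [NormedSpace ℝ E]
    {f : ℝ → E} (hf : Integrable f) (heven : ∀ x, f (-x) = f x) :
    ∫ x, f x = (2 : ℝ) • ∫ x in Ioi (0 : ℝ), f x := by
  rw [← setIntegral_univ, ← Iic_union_Ioi (a := (0 : ℝ)),
    setIntegral_union (Iic_disjoint_Ioi le_rfl) measurableSet_Ioi hf.integrableOn hf.integrableOn,
    two_smul]
  congr 1
  have := integral_comp_neg_Iic (0 : ℝ) f
  rw [neg_zero] at this
  rw [← this]
  simp [heven]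

theorem integrable_exp_mul_cosh (μ : ℂ) {z : ℂ} (hz : 0 < z.re) :
    Integrable fun u : ℝ => Complex.exp (-z * (Real.cosh u : ℂ)) * Complex.cosh (μ * u) := by
  have h := ((integrable_macdonald μ hz).add (integrable_macdonald (-μ) hz)).div_const 2
  refine h.congr (Eventually.of_forall fun u => ?_)
  simp only [Pi.add_apply, Complex.cosh]
  ring_nf

/-- The whole-line form, in which `cosh (μ u)` becomes a pure exponential by symmetry, is the one
suited to translations and convolutions. -/
theorem besselK_eq_macdonald (μ : ℂ) {z : ℂ} (hz : 0 < z.re) : besselK μ z = macdonald μ z := by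
  have h1 := integral_eq_two_mul_integral_Ioi (integrable_exp_mul_cosh μ hz) (fun u => by simp)
  have h2 : ∫ u : ℝ, Complex.exp (-z * (Real.cosh u : ℂ)) * Complex.cosh (μ * u)
      = macdonald μ z + macdonald (-μ) z := by
    unfold macdonald coshTransform
    rw [← add_div, ← integral_add (integrable_macdonald μ hz) (integrable_macdonald (-μ) hz),
      ← integral_div]
    congr 1
    ext u
    simp only [Complex.cosh]
    ring_nf
  rw [h2, macdonald_neg, ← two_mul, Complex.real_smul] at h1
  unfold besselK
  have : (2 : ℂ) ≠ 0 := two_ne_zero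
  rw [Complex.ofReal_ofNat] at h1
  exact (mul_left_cancel₀ this h1).symm

theorem hasDerivAt_macdonald (μ : ℂ) {z : ℂ} (hz : 0 < z.re) :
    HasDerivAt (macdonald μ) (-(macdonald (μ + 1) z + macdonald (μ - 1) z) / 2) z := by
  have h := (hasDerivAt_coshTransform (φ := fun u : ℝ => Complex.exp (μ * u)) (by fun_prop)
    (norm_exp_ofReal_mul_le μ) hz).div_const 2
  have key : coshTransform (fun u => (Real.cosh u : ℂ) * Complex.exp (μ * u)) z
      = macdonald (μ + 1) z + macdonald (μ - 1) z := by
    unfold macdonald coshTransform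
    rw [← add_div, ← integral_add (integrable_macdonald _ hz) (integrable_macdonald _ hz),
      ← integral_div]
    refine integral_congr_ae (Eventually.of_forall fun u => ?_)
    simp only
    rw [Complex.ofReal_cosh, Complex.cosh, add_mul μ, sub_mul μ, Complex.exp_add (μ * u), Complex.exp_sub,
      one_mul, Complex.exp_neg]
    ring
  rw [key] at h
  exact h

/-- The derivative in `u` of `exp (-z cosh u + μ u)` has integral zero over the line. -/
theorem macdonald_recurrence (μ : ℂ) {z : ℂ} (hz : 0 < z.re) :
    z * (macdonald (μ + 1) z - macdonald (μ - 1) z) = 2 * μ * macdonald μ z := by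
  have hI := (((integrable_macdonald (μ + 1) hz).sub (integrable_macdonald (μ - 1) hz)).const_mul
    (-z / 2)).add ((integrable_macdonald μ hz).const_mul μ)
  have hd : ∀ u : ℝ, HasDerivAt
      (fun u : ℝ => Complex.exp (-z * (Real.cosh u : ℂ)) * Complex.exp (μ * u))
      ((-z / 2) * (Complex.exp (-z * (Real.cosh u : ℂ)) * Complex.exp ((μ + 1) * u) -
        Complex.exp (-z * (Real.cosh u : ℂ)) * Complex.exp ((μ - 1) * u)) +
        μ * (Complex.exp (-z * (Real.cosh u : ℂ)) * Complex.exp (μ * u))) u := by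
    intro u
    have h1 : HasDerivAt (fun u : ℝ => Complex.exp (-z * (Real.cosh u : ℂ)))
        (Complex.exp (-z * (Real.cosh u : ℂ)) * (-z * (Real.sinh u : ℂ))) u :=
      ((Real.hasDerivAt_cosh u).ofReal_comp.const_mul (-z)).cexp
    have h2 : HasDerivAt (fun u : ℝ => Complex.exp (μ * u))
        (Complex.exp (μ * u) * (μ * 1)) u :=
      ((hasDerivAt_id (u : ℂ)).comp_ofReal.const_mul μ).cexp
    refine (h1.mul h2).congr_deriv ?_
    rw [Complex.ofReal_sinh, Complex.sinh, add_mul μ, sub_mul μ, Complex.exp_add, Complex.exp_sub,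
      one_mul, Complex.exp_neg]
    ring
  have h0 := integral_eq_zero_of_hasDerivAt_of_integrable hd hI (integrable_macdonald μ hz)
  have hadd := integral_add (((integrable_macdonald (μ + 1) hz).sub
      (integrable_macdonald (μ - 1) hz)).const_mul (-z / 2)) ((integrable_macdonald μ hz).const_mul μ)
  simp only [Pi.sub_apply] at hadd
  rw [hadd, integral_const_mul, integral_const_mul,
    integral_sub (integrable_macdonald _ hz) (integrable_macdonald _ hz)] at h0
  unfold macdonald coshTransform
  linear_combination -h0

theorem differentiableOn_macdonald (μ : ℂ) :
    DifferentiableOn ℂ (macdonald μ) {z | 0 < z.re} := fun _ hz =>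
  (hasDerivAt_macdonald μ hz).differentiableAt.differentiableWithinAt

/-- The Macdonald function of order `0` on the positive half-line, as a real function. -/
noncomputable def macdonaldReal (r : ℝ) : ℝ :=
  (∫ u : ℝ, Real.exp (-r * Real.cosh u)) / 2

theorem integrable_exp_neg_mul_cosh {r : ℝ} (hr : 0 < r) :
    Integrable fun u : ℝ => Real.exp (-r * Real.cosh u) := by
  simpa using integrable_exp_neg_mul_cosh_add r 0 hr

theorem macdonald_zero_ofReal (r : ℝ) : macdonald 0 r = (macdonaldReal r : ℂ) := by
  unfold macdonald coshTransform macdonaldReal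
  push_cast
  rw [← integral_complex_ofReal]
  simp

theorem norm_macdonald_zero_le (z : ℂ) : ‖macdonald 0 z‖ ≤ macdonaldReal z.re := by
  unfold macdonald coshTransform macdonaldReal
  rw [norm_div, Complex.norm_ofNat]
  gcongr
  refine (norm_integral_le_integral_norm _).trans_eq ?_
  congr 1
  ext u
  rw [norm_mul, norm_exp_neg_mul_cosh]
  simp

theorem macdonaldReal_anti {r s : ℝ} (hr : 0 < r) (hrs : r ≤ s) :
    macdonaldReal s ≤ macdonaldReal r := by
  unfold macdonaldReal
  gcongr
  · exact integrable_exp_neg_mul_cosh (hr.trans_le hrs)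
  · exact integrable_exp_neg_mul_cosh hr
  · intro u
    exact Real.exp_le_exp.2 (by nlinarith [Real.cosh_pos u])

theorem macdonaldReal_pos {r : ℝ} (hr : 0 < r) : 0 < macdonaldReal r := by
  unfold macdonaldReal
  have := integral_exp_pos (μ := volume) (integrable_exp_neg_mul_cosh hr)
  positivity

theorem continuousOn_macdonaldReal : ContinuousOn macdonaldReal (Ioi 0) := by
  have h : ContinuousOn (fun r : ℝ => (macdonald 0 r).re) (Ioi 0) := by
    refine Complex.continuous_re.comp_continuousOn ((differentiableOn_macdonald 0).continuousOn.comp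
      Complex.continuous_ofReal.continuousOn fun r hr => by simpa using hr)
  refine h.congr fun r _ => ?_
  simp [macdonald_zero_ofReal]

/-! ### Analytic continuation and the product formula -/

theorem isOpen_re_pos : IsOpen {z : ℂ | 0 < z.re} :=
  isOpen_lt continuous_const Complex.continuous_re

/-- Two functions holomorphic on the right half-plane that agree on the positive reals coincide. -/
theorem eqOn_re_pos_of_eq_ofReal {f g : ℂ → ℂ} (hf : DifferentiableOn ℂ f {z | 0 < z.re})
    (hg : DifferentiableOn ℂ g {z | 0 < z.re}) (h : ∀ r : ℝ, 0 < r → f r = g r) :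
    EqOn f g {z | 0 < z.re} := by
  refine (hf.analyticOnNhd isOpen_re_pos).eqOn_of_preconnected_of_frequently_eq
    (hg.analyticOnNhd isOpen_re_pos) (convex_halfSpace_re_gt 0).isPreconnected
    (z₀ := ((1 : ℝ) : ℂ)) (by simp) ?_
  have ht : Tendsto (fun r : ℝ => (r : ℂ)) (𝓝[≠] 1) (𝓝[≠] ((1 : ℝ) : ℂ)) := by
    refine tendsto_nhdsWithin_of_tendsto_nhds_of_eventually_within _
      (Complex.continuous_ofReal.continuousAt.tendsto.mono_left nhdsWithin_le_nhds) ?_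
    filter_upwards [self_mem_nhdsWithin] with r hr
    simpa using hr
  refine ht.frequently (Eventually.frequently ?_)
  filter_upwards [nhdsWithin_le_nhds (Ioi_mem_nhds (zero_lt_one' ℝ))] with r hr
  exact h r hr

theorem cpow_inv_two_re_pos {ζ : ℂ} (hζ : ζ ∈ Complex.slitPlane) : 0 < (ζ ^ (2⁻¹ : ℂ)).re := by
  rw [Complex.cpow_inv_two_re]
  apply Real.sqrt_pos.2
  rcases hζ with h | h
  · have := norm_nonneg ζ
    linarith
  · have h1 := Complex.abs_re_lt_norm.2 h
    have h2 := neg_abs_le ζ.re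
    linarith

theorem differentiableOn_cpow_inv_two :
    DifferentiableOn ℂ (fun ζ : ℂ => ζ ^ (2⁻¹ : ℂ)) Complex.slitPlane := fun _ hζ =>
  ((hasDerivAt_id _).cpow_const hζ).differentiableAt.differentiableWithinAt

theorem differentiableOn_macdonald_sqrt :
    DifferentiableOn ℂ (fun ζ : ℂ => macdonald 0 (ζ ^ (2⁻¹ : ℂ))) Complex.slitPlane :=
  (differentiableOn_macdonald 0).comp differentiableOn_cpow_inv_two
    fun _ hζ => cpow_inv_two_re_pos hζ

/-- The imaginary part is `2 Im Y (Re Y + X cosh w)`, which vanishes only for real `Y`, and then the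
number is positive. Hence the principal root is holomorphic in `Y`. -/
theorem addition_mem_slitPlane {X : ℝ} (hX : 0 < X) {Y : ℂ} (hY : 0 < Y.re) (w : ℝ) :
    Y ^ 2 + X ^ 2 + 2 * X * Y * Real.cosh w ∈ Complex.slitPlane := by
  have hc := Real.cosh_pos w
  have him : (Y ^ 2 + X ^ 2 + 2 * X * Y * Real.cosh w).im = 2 * Y.im * (Y.re + X * Real.cosh w) := by
    simp only [pow_two, Complex.add_im, Complex.mul_im, Complex.mul_re, Complex.ofReal_re,
      Complex.ofReal_im, Complex.re_ofNat, Complex.im_ofNat]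
    ring
  have hre : (Y ^ 2 + X ^ 2 + 2 * X * Y * Real.cosh w).re
      = Y.re ^ 2 - Y.im ^ 2 + X ^ 2 + 2 * X * Y.re * Real.cosh w := by
    simp only [pow_two, Complex.add_re, Complex.mul_im, Complex.mul_re, Complex.ofReal_re,
      Complex.ofReal_im, Complex.re_ofNat, Complex.im_ofNat]
    ring
  by_cases h : Y.im = 0
  · left
    have h1 : 0 < X * Y.re * Real.cosh w := by positivity
    rw [hre, h]
    nlinarith [sq_nonneg Y.re]
  · right
    rw [him]
    have : 0 < Y.re + X * Real.cosh w := by positivity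
    exact mul_ne_zero (mul_ne_zero two_ne_zero h) this.ne'

theorem norm_exp_neg_mul_cosh_sub_le {X : ℝ} (hX : 0 < X) (w t : ℝ) :
    ‖Complex.exp (-(X : ℂ) * (Real.cosh (w - t) : ℂ))‖ ≤ 1 * Real.exp (0 * |t|) := by
  rw [norm_exp_neg_mul_cosh, zero_mul, Real.exp_zero, mul_one]
  apply Real.exp_le_one_iff.2
  have := Real.cosh_pos (w - t)
  have : 0 < X * Real.cosh (w - t) := by positivity
  simp only [Complex.ofReal_re]
  linarith

/-- The left side is `(a² e^t + b² e^{-t})/2` with `a² = Y + X e^{-w}` and `b² = Y + X e^w`.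
Balancing the two coefficients gives amplitude `ab` and shift `log (a/b)`. -/
theorem cosh_addition_ofReal {X Y : ℝ} (hX : 0 < X) (hY : 0 < Y) (w : ℝ) :
    ∃ α : ℝ, ∀ t, Y * Real.cosh t + X * Real.cosh (w - t)
      = √(Y ^ 2 + X ^ 2 + 2 * X * Y * Real.cosh w) * Real.cosh (t + α) := by
  have hE := Real.exp_pos w
  obtain ⟨a, ha⟩ : ∃ a, a = √(Y + X * Real.exp (-w)) := ⟨_, rfl⟩
  obtain ⟨b, hb⟩ : ∃ b, b = √(Y + X * Real.exp w) := ⟨_, rfl⟩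
  have ha0 : 0 < a := ha ▸ Real.sqrt_pos.2 (by positivity)
  have hb0 : 0 < b := hb ▸ Real.sqrt_pos.2 (by positivity)
  have ha2 : a ^ 2 = Y + X * Real.exp (-w) := by rw [ha, Real.sq_sqrt (by positivity)]
  have hb2 : b ^ 2 = Y + X * Real.exp w := by rw [hb, Real.sq_sqrt (by positivity)]
  have hR : √(Y ^ 2 + X ^ 2 + 2 * X * Y * Real.cosh w) = a * b := by
    rw [Real.sqrt_eq_iff_mul_self_eq_of_pos (by positivity)]
    rw [show a * b * (a * b) = a ^ 2 * b ^ 2 by ring, ha2, hb2, Real.cosh_eq, Real.exp_neg]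
    field_simp
    ring
  refine ⟨Real.log (a / b), fun t => ?_⟩
  rw [hR, Real.cosh_eq (t + _), neg_add, Real.exp_add, Real.exp_add, Real.exp_neg (Real.log _),
    Real.exp_log (by positivity)]
  have : a * b * ((Real.exp t * (a / b) + Real.exp (-t) * (a / b)⁻¹) / 2)
      = (Real.exp t * a ^ 2 + Real.exp (-t) * b ^ 2) / 2 := by
    field_simp
  rw [this, ha2, hb2, Real.cosh_eq, Real.cosh_eq, Real.exp_neg, Real.exp_neg, Real.exp_neg,
    Real.exp_sub]
  field_simp
  ring

theorem coshTransform_exp_cosh_ofReal {X Y : ℝ} (hX : 0 < X) (hY : 0 < Y) (w : ℝ) :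
    coshTransform (fun t => Complex.exp (-(X : ℂ) * (Real.cosh (w - t) : ℂ))) Y
      = 2 * macdonald 0 (((Y : ℂ) ^ 2 + X ^ 2 + 2 * X * Y * Real.cosh w) ^ (2⁻¹ : ℂ)) := by
  obtain ⟨α, hα⟩ := cosh_addition_ofReal hX hY w
  have hR : (((Y : ℂ) ^ 2 + X ^ 2 + 2 * X * Y * Real.cosh w) ^ (2⁻¹ : ℂ))
      = (√(Y ^ 2 + X ^ 2 + 2 * X * Y * Real.cosh w) : ℝ) := by
    rw [Real.sqrt_eq_rpow, Complex.ofReal_cpow]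
    · norm_num
    · have := Real.cosh_pos w
      positivity
  rw [hR]
  unfold macdonald coshTransform
  rw [mul_div_cancel₀ _ (two_ne_zero' ℂ), ← integral_add_right_eq_self
    (fun u : ℝ => Complex.exp (-((√(Y ^ 2 + X ^ 2 + 2 * X * Y * Real.cosh w) : ℝ) : ℂ) *
      (Real.cosh u : ℂ)) * Complex.exp (0 * (u : ℂ))) α]
  refine integral_congr_ae (Eventually.of_forall fun t => ?_)
  simp only [zero_mul, Complex.exp_zero, mul_one]
  rw [← Complex.exp_add]
  congr 1
  have := congrArg (fun r : ℝ => (r : ℂ)) (hα t)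
  simp only [Complex.ofReal_add, Complex.ofReal_mul] at this ⊢
  linear_combination -this

/-- Both sides are holomorphic in `Y`. For complex `Y` the shift would be complex, so the identity
is continued from the positive reals. -/
theorem coshTransform_exp_cosh {X : ℝ} (hX : 0 < X) {Y : ℂ} (hY : 0 < Y.re) (w : ℝ) :
    coshTransform (fun t => Complex.exp (-(X : ℂ) * (Real.cosh (w - t) : ℂ))) Y
      = 2 * macdonald 0 ((Y ^ 2 + X ^ 2 + 2 * X * Y * Real.cosh w) ^ (2⁻¹ : ℂ)) := by
  refine eqOn_re_pos_of_eq_ofReal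
    (g := fun Y => 2 * macdonald 0 ((Y ^ 2 + X ^ 2 + 2 * X * Y * Real.cosh w) ^ (2⁻¹ : ℂ)))
    (differentiableOn_coshTransform (by fun_prop) (norm_exp_neg_mul_cosh_sub_le hX w)) ?_
    (fun r hr => coshTransform_exp_cosh_ofReal hX hr w) hY
  refine DifferentiableOn.const_mul ?_ 2
  exact differentiableOn_macdonald_sqrt.comp
    (f := fun Y : ℂ => Y ^ 2 + X ^ 2 + 2 * X * Y * Real.cosh w) (by fun_prop)
    fun Y hY => addition_mem_slitPlane hX hY w

/-- The exponentials in `t` and `w - t` combine to `e^{νw}`, leaving an integral of order zero. -/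
theorem convolution_macdonald_integrand {X : ℝ} (hX : 0 < X) {Y : ℂ} (hY : 0 < Y.re) (ν : ℂ)
    (w : ℝ) :
    (convolution (fun t : ℝ => Complex.exp (-Y * (Real.cosh t : ℂ)) * Complex.exp (ν * t))
      (fun t : ℝ => Complex.exp (-(X : ℂ) * (Real.cosh t : ℂ)) * Complex.exp (ν * t))
      (ContinuousLinearMap.mul ℂ ℂ) volume) w
    = 2 * (Complex.exp (ν * w) *
        macdonald 0 ((Y ^ 2 + X ^ 2 + 2 * X * Y * Real.cosh w) ^ (2⁻¹ : ℂ))) := by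
  rw [mul_left_comm, ← coshTransform_exp_cosh hX hY]
  unfold convolution coshTransform
  rw [← integral_const_mul]
  refine integral_congr_ae (Eventually.of_forall fun t => ?_)
  simp only [ContinuousLinearMap.mul_apply']
  rw [show ν * w = ν * t + ν * ((w - t : ℝ) : ℂ) by push_cast; ring, Complex.exp_add]
  ring

/-- The integrand of the product formula is integrable. -/
theorem integrable_macdonald_product {X : ℝ} (hX : 0 < X) {Y : ℂ} (hY : 0 < Y.re) (ν : ℂ) :
    Integrable fun w : ℝ => Complex.exp (ν * w) *
      macdonald 0 ((Y ^ 2 + X ^ 2 + 2 * X * Y * Real.cosh w) ^ (2⁻¹ : ℂ)) := by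
  have h := (integrable_macdonald ν hY).integrable_convolution (ContinuousLinearMap.mul ℂ ℂ)
    (integrable_macdonald ν (z := (X : ℂ)) (by simpa using hX))
  refine (h.div_const 2).congr (Eventually.of_forall fun w => ?_)
  simp only [convolution_macdonald_integrand hX hY]
  field_simp

/-- Macdonald's product formula. -/
theorem macdonald_mul_macdonald {X : ℝ} (hX : 0 < X) {Y : ℂ} (hY : 0 < Y.re) (ν : ℂ) :
    macdonald ν X * macdonald ν Y = (∫ w : ℝ, Complex.exp (ν * w) *
      macdonald 0 ((Y ^ 2 + X ^ 2 + 2 * X * Y * Real.cosh w) ^ (2⁻¹ : ℂ))) / 2 := by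
  have h := integral_convolution (ContinuousLinearMap.mul ℂ ℂ) (integrable_macdonald ν hY)
    (integrable_macdonald ν (z := (X : ℂ)) (by simpa using hX))
  simp only [convolution_macdonald_integrand hX hY, ContinuousLinearMap.mul_apply'] at h
  rw [integral_const_mul] at h
  unfold macdonald at *
  unfold coshTransform at *
  linear_combination -h / 4

/-! ### The power series behind the Bessel functions -/

/-- The coefficients `1 / (k! Γ(ν + k + 1))`. -/
noncomputable def besselCoeff (ν : ℂ) (k : ℕ) : ℂ :=
  ((k.factorial : ℂ) * Complex.Gamma (ν + k + 1))⁻¹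

/-- The entire function `∑ w ^ k / (k! Γ(ν + k + 1))` underlying the Bessel functions of order
`ν`. -/
noncomputable def besselSeries (ν w : ℂ) : ℂ := ∑' k : ℕ, besselCoeff ν k * w ^ k

theorem besselCoeff_succ_mul (ν : ℂ) (k : ℕ) :
    besselCoeff ν (k + 1) * ((k : ℂ) + 1) = besselCoeff (ν + 1) k := by
  have hk : (k : ℂ) + 1 ≠ 0 := Nat.cast_add_one_ne_zero k
  unfold besselCoeff
  rw [Nat.factorial_succ]
  push_cast
  rw [show ν + ((k : ℂ) + 1) + 1 = ν + 1 + k + 1 by ring, mul_assoc, mul_inv, mul_comm,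
    mul_inv_cancel_left₀ hk]

theorem besselCoeff_eq_mul_add_one (ν : ℂ) (k : ℕ) :
    besselCoeff ν k = (ν + k + 1) * besselCoeff (ν + 1) k := by
  unfold besselCoeff
  rw [mul_inv, mul_inv, Complex.one_div_Gamma_eq_self_mul_one_div_Gamma_add_one,
    show ν + (k : ℂ) + 1 + 1 = ν + 1 + k + 1 by ring]
  ring

theorem summable_norm_besselCoeff_mul_pow (ν : ℂ) (R : ℝ) :
    Summable fun k : ℕ => ‖besselCoeff ν k‖ * R ^ k := by
  refine summable_of_ratio_norm_eventually_le (r := 1 / 2) (by norm_num) ?_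
  filter_upwards [eventually_ge_atTop ⌈‖ν‖⌉₊, eventually_ge_atTop ⌈2 * |R|⌉₊] with k hk1 hk2
  have hk1' : ‖ν‖ ≤ k := Nat.ceil_le.1 hk1
  have hk2' : 2 * |R| ≤ k := Nat.ceil_le.1 hk2
  have h1 : 1 ≤ ‖ν + k + 1‖ := by
    have h := norm_sub_norm_le ((k : ℂ) + 1) (-ν)
    rw [norm_neg, show (k : ℂ) + 1 - -ν = ν + k + 1 by ring] at h
    have h2 : ‖(k : ℂ) + 1‖ = k + 1 := by
      rw [show (k : ℂ) + 1 = ((k + 1 : ℕ) : ℂ) by push_cast; rfl, Complex.norm_natCast]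
      push_cast; rfl
    linarith
  have h2 : ‖besselCoeff ν (k + 1)‖ * (k + 1) ≤ ‖besselCoeff ν k‖ := by
    -- The ratio is written as a product, so coefficients that vanish at poles of `Γ` need no
    -- separate case.
    have e : besselCoeff ν k = (ν + k + 1) * (besselCoeff ν (k + 1) * ((k : ℂ) + 1)) := by
      rw [besselCoeff_succ_mul, besselCoeff_eq_mul_add_one]
    have h2 : ‖(k : ℂ) + 1‖ = k + 1 := by
      rw [show (k : ℂ) + 1 = ((k + 1 : ℕ) : ℂ) by push_cast; rfl, Complex.norm_natCast]
      push_cast; rfl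
    rw [e, norm_mul, norm_mul, h2]
    exact le_mul_of_one_le_left (by positivity) h1
  simp only [norm_mul, norm_pow, Real.norm_eq_abs, abs_norm]
  rw [pow_succ]
  have h3 : ‖besselCoeff ν (k + 1)‖ * |R| ≤ 1 / 2 * ‖besselCoeff ν k‖ := by
    have : ‖besselCoeff ν (k + 1)‖ * |R| ≤ ‖besselCoeff ν (k + 1)‖ * ((k + 1) / 2) := by
      gcongr
      linarith
    linarith
  calc ‖besselCoeff ν (k + 1)‖ * (|R| ^ k * |R|) = |R| ^ k * (‖besselCoeff ν (k + 1)‖ * |R|) := by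
        ring
    _ ≤ |R| ^ k * (1 / 2 * ‖besselCoeff ν k‖) := by gcongr
    _ = _ := by ring

theorem summable_besselSeries (ν w : ℂ) : Summable fun k : ℕ => besselCoeff ν k * w ^ k := by
  refine Summable.of_norm ?_
  simpa only [norm_mul, norm_pow] using summable_norm_besselCoeff_mul_pow ν ‖w‖

theorem tsum_besselCoeff_deriv (ν w : ℂ) :
    ∑' k : ℕ, besselCoeff ν k * ((k : ℂ) * w ^ (k - 1)) = besselSeries (ν + 1) w := by
  have hs : ∀ k : ℕ, besselCoeff ν (k + 1) * (((k + 1 : ℕ) : ℂ) * w ^ (k + 1 - 1))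
      = besselCoeff (ν + 1) k * w ^ k := fun k => by
    rw [← besselCoeff_succ_mul]
    push_cast [Nat.add_sub_cancel]
    ring
  have h : Summable fun k : ℕ => besselCoeff ν k * ((k : ℂ) * w ^ (k - 1)) := by
    rw [← summable_nat_add_iff 1]
    simpa only [hs] using summable_besselSeries (ν + 1) w
  rw [h.tsum_eq_zero_add]
  simp only [hs]
  simp [besselSeries]

theorem hasDerivAt_besselSeries (ν w : ℂ) :
    HasDerivAt (besselSeries ν) (besselSeries (ν + 1) w) w := by
  rw [← tsum_besselCoeff_deriv]
  obtain ⟨R, hR⟩ : ∃ R : ℝ, R = ‖w‖ + 1 := ⟨_, rfl⟩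
  have hR1 : 1 ≤ R := by rw [hR]; linarith [norm_nonneg w]
  -- The factor `2 ^ k` absorbs the `k` of the differentiated term; `R ≥ 1` absorbs the lowered
  -- exponent.
  refine hasDerivAt_tsum_of_isPreconnected (u := fun k => ‖besselCoeff ν k‖ * (2 * R) ^ k)
    (g := fun k w => besselCoeff ν k * w ^ k)
    (g' := fun k w => besselCoeff ν k * ((k : ℂ) * w ^ (k - 1)))
    (t := Metric.ball 0 R) (y₀ := 0)
    (summable_norm_besselCoeff_mul_pow ν (2 * R)) Metric.isOpen_ball
    (convex_ball _ _).isPreconnected (fun k y _ => (hasDerivAt_pow k y).const_mul _)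
    (fun k y hy => ?_) (Metric.mem_ball_self (by linarith)) (summable_besselSeries ν 0)
    (by simp [hR])
  rw [norm_mul, norm_mul, norm_pow, Complex.norm_natCast, mul_pow]
  have hy' : ‖y‖ ≤ R := by simpa using (Metric.mem_ball.1 hy).le
  gcongr
  · exact_mod_cast Nat.lt_two_pow_self.le
  · exact (pow_le_pow_left₀ (norm_nonneg _) hy' _).trans (pow_le_pow_right₀ hR1 (Nat.sub_le _ _))

theorem besselSeries_recurrence (ν w : ℂ) :
    besselSeries ν w = (ν + 1) * besselSeries (ν + 1) w + w * besselSeries (ν + 2) w := by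
  have h1 : ∀ k : ℕ, besselCoeff (ν + 1) k * ((k : ℂ) * w ^ (k - 1)) * w
      = besselCoeff ν k * w ^ k - (ν + 1) * (besselCoeff (ν + 1) k * w ^ k) := fun k => by
    rw [besselCoeff_eq_mul_add_one ν]
    rcases k with _ | k
    · simp
    · rw [Nat.add_sub_cancel, pow_succ]
      ring
  have h2 := tsum_besselCoeff_deriv (ν + 1) w
  rw [show ν + 1 + 1 = ν + 2 by ring] at h2
  rw [mul_comm w, ← h2, ← tsum_mul_right]
  simp only [h1]
  rw [(summable_besselSeries ν w).tsum_sub ((summable_besselSeries (ν + 1) w).mul_left _),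
    tsum_mul_left]
  unfold besselSeries
  ring

theorem besselSeries_zero (ν : ℂ) : besselSeries ν 0 = (Complex.Gamma (ν + 1))⁻¹ := by
  unfold besselSeries
  rw [tsum_eq_single 0 (fun k hk => by simp [hk])]
  simp [besselCoeff]

theorem differentiable_besselSeries (ν : ℂ) : Differentiable ℂ (besselSeries ν) := fun w =>
  (hasDerivAt_besselSeries ν w).differentiableAt

theorem besselJ_eq (ν z : ℂ) : besselJ ν z = (z / 2) ^ ν * besselSeries ν (-(z / 2) ^ 2) := by
  unfold besselJ besselSeries besselCoeff
  congr 2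
  ext k
  rw [neg_pow ((z / 2) ^ 2), ← pow_mul]
  ring

/-! ### Uniqueness at the origin and the connection formula -/

/-- A solution of the modified Bessel equation, written as a first order system for `a` and `b`,
vanishes if `a` and `b` tend to `0` at the origin. -/
theorem eq_zero_of_bessel_system {ν : ℂ} (hν : ν ≠ 0) (hre : ν.re = 0) {u a b : ℝ → ℂ}
    (ha : ∀ h : ℝ, 0 < h → HasDerivAt a (4 * (h : ℂ) ^ (ν + 1) * u h) h)
    (hb : ∀ h : ℝ, 0 < h → HasDerivAt b (4 * (h : ℂ) ^ (1 - ν) * u h) h)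
    (hu : ∀ h : ℝ, 0 < h → (h : ℂ) ^ ν * b h - (h : ℂ) ^ (-ν) * a h = 2 * ν * u h)
    (ha0 : Tendsto a (𝓝[>] 0) (𝓝 0)) (hb0 : Tendsto b (𝓝[>] 0) (𝓝 0)) {x : ℝ} (hx : 0 < x) :
    u x = 0 := by
  have hν' : 0 < ‖ν‖ := norm_pos_iff.2 hν
  obtain ⟨K, hK⟩ : ∃ K : ℝ, K = 4 * x / ‖ν‖ := ⟨_, rfl⟩
  -- Imaginary order enters here: `|h^{±ν}| = 1`, so `u` is controlled by the pair `(a, b)` without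
  -- a singular factor.
  have hunorm : ∀ h : ℝ, 0 < h → ‖u h‖ ≤ ‖(a h, b h)‖ / ‖ν‖ := by
    intro h hh
    rw [le_div_iff₀ hν']
    have h1 : ‖2 * ν * u h‖ ≤ ‖b h‖ + ‖a h‖ := by
      rw [← hu h hh]
      refine (norm_sub_le _ _).trans_eq ?_
      rw [norm_mul, norm_mul, Complex.norm_cpow_eq_rpow_re_of_pos hh,
        Complex.norm_cpow_eq_rpow_re_of_pos hh]
      simp [hre]
    rw [norm_mul, norm_mul, Complex.norm_ofNat] at h1
    have h2 : ‖a h‖ ≤ ‖(a h, b h)‖ := norm_fst_le (a h, b h)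
    have h3 : ‖b h‖ ≤ ‖(a h, b h)‖ := norm_snd_le (a h, b h)
    linarith
  have hpair : Tendsto (fun ε => (a ε, b ε)) (𝓝[>] 0) (𝓝 0) := ha0.prodMk_nhds hb0
  have hlim : Tendsto (fun ε => ‖(a ε, b ε)‖ * Real.exp (K * (x - ε))) (𝓝[>] 0) (𝓝 0) := by
    have h2 : Tendsto (fun ε : ℝ => Real.exp (K * (x - ε))) (𝓝[>] 0)
        (𝓝 (Real.exp (K * (x - 0)))) :=
      (by fun_prop : Continuous fun ε : ℝ => Real.exp (K * (x - ε))).continuousAt.tendsto.mono_left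
        nhdsWithin_le_nhds
    simpa using hpair.norm.mul h2
  have hle : ‖(a x, b x)‖ ≤ 0 := by
    refine ge_of_tendsto hlim ?_
    filter_upwards [Ioo_mem_nhdsGT hx] with ε hε
    have hd : ∀ h ∈ Icc ε x, HasDerivAt (fun h => (a h, b h))
        (4 * (h : ℂ) ^ (ν + 1) * u h, 4 * (h : ℂ) ^ (1 - ν) * u h) h := fun h hh =>
      (ha h (hε.1.trans_le hh.1)).prodMk (hb h (hε.1.trans_le hh.1))
    -- Gronwall is applied on `[ε, x]`, and the left endpoint goes to `0` afterwards. The named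
    -- argument `ε := 0` is the inhomogeneous term of the bound, not that endpoint.
    have hg := norm_le_gronwallBound_of_norm_deriv_right_le (K := K) (ε := 0)
      (fun h hh => (hd h hh).continuousAt.continuousWithinAt)
      (fun h hh => (hd h ⟨hh.1, hh.2.le⟩).hasDerivWithinAt) le_rfl (fun h hh => ?_)
      x ⟨hε.2.le, le_rfl⟩
    · rwa [gronwallBound_ε0] at hg
    · have h0 : 0 < h := hε.1.trans_le hh.1
      have h1 := hunorm h h0
      have key : 4 * h * ‖u h‖ ≤ K * ‖(a h, b h)‖ := by
        calc 4 * h * ‖u h‖ ≤ 4 * x * (‖(a h, b h)‖ / ‖ν‖) := by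
              have := hh.2.le
              gcongr
          _ = _ := by rw [hK]; ring
      rw [add_zero, Prod.norm_mk]
      refine max_le ?_ ?_ <;>
      · rw [norm_mul, norm_mul, Complex.norm_cpow_eq_rpow_re_of_pos h0]
        simpa [hre] using key
  have h0 := hunorm x hx
  have : ‖u x‖ ≤ 0 := h0.trans (by
    have := div_le_div_of_nonneg_right hle hν'.le
    simpa using this)
  simpa using this

theorem hasDerivAt_ofReal_cpow_const_of_pos (μ : ℂ) {h : ℝ} (hh : 0 < h) :
    HasDerivAt (fun h : ℝ => (h : ℂ) ^ μ) (μ * (h : ℂ) ^ (μ - 1)) h := by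
  have := ((hasDerivAt_id (h : ℂ)).cpow_const (c := μ) (Or.inl (by simpa using hh))).comp_ofReal
  simpa using this

theorem hasDerivAt_besselSeries_sq (ν : ℂ) (h : ℝ) :
    HasDerivAt (fun h : ℝ => besselSeries ν ((h : ℂ) ^ 2))
      (2 * h * besselSeries (ν + 1) ((h : ℂ) ^ 2)) h := by
  have h1 := ((hasDerivAt_besselSeries ν ((h : ℂ) ^ 2)).comp (h : ℂ)
    (hasDerivAt_pow 2 (h : ℂ))).comp_ofReal
  refine h1.congr_deriv ?_
  norm_num
  ring

/-- The component `a` of the system for the solution `h^ν ∑ h^{2k} / (k! Γ(ν+k+1))`, that is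
`I_ν(2h)`; `hasDerivAt_besselSeries_sub_one` gives `b`. For the solution of order `-ν` the two
exchange roles. -/
theorem hasDerivAt_cpow_mul_besselSeries (ν : ℂ) {h : ℝ} (hh : 0 < h) :
    HasDerivAt (fun h : ℝ => 2 * ((h : ℂ) ^ (2 * ν + 2) * besselSeries (ν + 1) ((h : ℂ) ^ 2)))
      (4 * (h : ℂ) ^ (ν + 1) * ((h : ℂ) ^ ν * besselSeries ν ((h : ℂ) ^ 2))) h := by
  have h0 : (h : ℂ) ≠ 0 := by exact_mod_cast hh.ne'
  refine (((hasDerivAt_ofReal_cpow_const_of_pos (2 * ν + 2) hh).mul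
    (hasDerivAt_besselSeries_sq (ν + 1) h)).const_mul 2).congr_deriv ?_
  rw [besselSeries_recurrence ν, show ν + 1 + 1 = ν + 2 by ring,
    show 2 * ν + 2 - 1 = ν + 1 + ν by ring, show 2 * ν + 2 = ν + 1 + ν + 1 by ring,
    Complex.cpow_add _ 1 h0, Complex.cpow_one, Complex.cpow_add _ _ h0]
  ring

theorem hasDerivAt_besselSeries_sub_one (ν : ℂ) {h : ℝ} (hh : 0 < h) :
    HasDerivAt (fun h : ℝ => 2 * besselSeries (ν - 1) ((h : ℂ) ^ 2))
      (4 * (h : ℂ) ^ (1 - ν) * ((h : ℂ) ^ ν * besselSeries ν ((h : ℂ) ^ 2))) h := by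
  have h0 : (h : ℂ) ≠ 0 := by exact_mod_cast hh.ne'
  refine ((hasDerivAt_besselSeries_sq (ν - 1) h).const_mul 2).congr_deriv ?_
  have h1 : (h : ℂ) ^ (1 - ν) * (h : ℂ) ^ ν = h := by
    rw [← Complex.cpow_add _ _ h0, sub_add_cancel, Complex.cpow_one]
  rw [sub_add_cancel]
  linear_combination -4 * besselSeries ν ((h : ℂ) ^ 2) * h1

theorem besselSeries_three_term (ν : ℂ) {h : ℝ} (hh : 0 < h) :
    (h : ℂ) ^ ν * (2 * besselSeries (ν - 1) ((h : ℂ) ^ 2)) - (h : ℂ) ^ (-ν) *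
      (2 * ((h : ℂ) ^ (2 * ν + 2) * besselSeries (ν + 1) ((h : ℂ) ^ 2)))
      = 2 * ν * ((h : ℂ) ^ ν * besselSeries ν ((h : ℂ) ^ 2)) := by
  have h0 : (h : ℂ) ≠ 0 := by exact_mod_cast hh.ne'
  have h1 : (h : ℂ) ^ (-ν) * (h : ℂ) ^ (2 * ν + 2) = (h : ℂ) ^ ν * (h : ℂ) ^ 2 := by
    rw [← Complex.cpow_add _ _ h0, show -ν + (2 * ν + 2) = ν + 2 by ring, Complex.cpow_add _ _ h0,
      Complex.cpow_ofNat]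
  have h2 := besselSeries_recurrence (ν - 1) ((h : ℂ) ^ 2)
  rw [sub_add_cancel, show ν - 1 + 2 = ν + 1 by ring] at h2
  rw [h2]
  linear_combination -2 * besselSeries (ν + 1) ((h : ℂ) ^ 2) * h1

/-- The component `a` for `K_ν(2h)`. As `K` is even in its order, replacing `ν` by `-ν` gives `b`.
-/
theorem hasDerivAt_cpow_mul_macdonald (ν : ℂ) {h : ℝ} (hh : 0 < h) :
    HasDerivAt (fun h : ℝ => -2 * ((h : ℂ) ^ (ν + 1) * macdonald (ν + 1) (2 * h)))
      (4 * (h : ℂ) ^ (ν + 1) * macdonald ν (2 * h)) h := by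
  have h0 : (h : ℂ) ≠ 0 := by exact_mod_cast hh.ne'
  have hre : 0 < ((2 : ℂ) * h).re := by simpa using hh
  have hm := ((hasDerivAt_macdonald (ν + 1) hre).comp (h : ℂ)
    ((hasDerivAt_id (h : ℂ)).const_mul 2)).comp_ofReal
  refine (((hasDerivAt_ofReal_cpow_const_of_pos (ν + 1) hh).mul hm).const_mul (-2)).congr_deriv ?_
  have hr := macdonald_recurrence (ν + 1) hre
  have hp : (h : ℂ) ^ (ν + 1) = (h : ℂ) ^ ν * h := by rw [Complex.cpow_add _ _ h0, Complex.cpow_one]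
  simp only [Function.comp_apply, add_sub_cancel_right] at hr ⊢
  rw [hp]
  linear_combination (h : ℂ) ^ ν * hr

theorem macdonald_three_term (ν : ℂ) {h : ℝ} (hh : 0 < h) :
    (h : ℂ) ^ ν * (-2 * ((h : ℂ) ^ (-ν + 1) * macdonald (-ν + 1) (2 * h))) - (h : ℂ) ^ (-ν) *
      (-2 * ((h : ℂ) ^ (ν + 1) * macdonald (ν + 1) (2 * h))) = 2 * ν * macdonald ν (2 * h) := by
  have h0 : (h : ℂ) ≠ 0 := by exact_mod_cast hh.ne'
  have hre : 0 < ((2 : ℂ) * h).re := by simpa using hh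
  have h1 : (h : ℂ) ^ ν * (h : ℂ) ^ (-ν + 1) = h := by
    rw [← Complex.cpow_add _ _ h0, add_neg_cancel_left, Complex.cpow_one]
  have h2 : (h : ℂ) ^ (-ν) * (h : ℂ) ^ (ν + 1) = h := by
    rw [← Complex.cpow_add _ _ h0, neg_add_cancel_left, Complex.cpow_one]
  have hr := macdonald_recurrence ν hre
  rw [← macdonald_neg (ν - 1), neg_sub, show (1 : ℂ) - ν = -ν + 1 by ring] at hr
  linear_combination hr - 2 * macdonald (-ν + 1) (2 * h) * h1 + 2 * macdonald (ν + 1) (2 * h) * h2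

theorem integrable_exp_sub_exp {μ : ℂ} (hμ : 0 < μ.re) :
    Integrable (fun v : ℝ => Complex.exp (μ * v - Real.exp v)) ∧
      ∫ v : ℝ, Complex.exp (μ * v - Real.exp v) = Complex.Gamma μ := by
  have himg : Real.exp '' univ = Ioi 0 := by rw [image_univ, Real.range_exp]
  have hd : ∀ x ∈ univ, HasDerivWithinAt Real.exp (Real.exp x) univ x := fun x _ =>
    (Real.hasDerivAt_exp x).hasDerivWithinAt
  have hfun : ∀ v : ℝ, |Real.exp v| • ((Real.exp (-Real.exp v) : ℂ) * ((Real.exp v : ℝ) : ℂ) ^ (μ - 1))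
      = Complex.exp (μ * v - Real.exp v) := fun v => by
    rw [Real.abs_exp, Complex.real_smul, Complex.cpow_def_of_ne_zero (by simp),
      ← Complex.ofReal_log (Real.exp_nonneg _), Real.log_exp]
    simp only [Complex.ofReal_exp, Complex.ofReal_neg]
    rw [← Complex.exp_add, ← Complex.exp_add]
    congr 1
    ring
  constructor
  · have h := Complex.GammaIntegral_convergent hμ
    rw [← himg, integrableOn_image_iff_integrableOn_abs_deriv_smul MeasurableSet.univ hd
      Real.exp_injective.injOn, integrableOn_univ] at h
    exact h.congr (Eventually.of_forall hfun)
  · rw [Complex.Gamma_eq_integral hμ, Complex.GammaIntegral, ← himg,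
      integral_image_eq_integral_abs_deriv_smul MeasurableSet.univ hd Real.exp_injective.injOn,
      setIntegral_univ]
    exact (integral_congr_ae (Eventually.of_forall hfun)).symm

/-- The substitution `v = u + log h` turns `2h cosh u` into `e^v + h² e^{-v}`, so that for `Re μ >
0` a Gamma integral appears as `h → 0`. -/
theorem cpow_mul_macdonald_eq (μ : ℂ) {h : ℝ} (hh : 0 < h) :
    (h : ℂ) ^ μ * macdonald μ (2 * h) =
      (∫ v : ℝ, Complex.exp (μ * v - Real.exp v) * Real.exp (-(h ^ 2 * Real.exp (-v)))) / 2 := by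
  have h0 : (h : ℂ) ≠ 0 := by exact_mod_cast hh.ne'
  unfold macdonald coshTransform
  rw [← mul_div_assoc, ← integral_const_mul]
  congr 1
  rw [← integral_add_right_eq_self (fun v : ℝ => Complex.exp (μ * v - Real.exp v) *
    (Real.exp (-(h ^ 2 * Real.exp (-v))) : ℂ)) (Real.log h)]
  refine integral_congr_ae (Eventually.of_forall fun u => ?_)
  simp only
  rw [Complex.cpow_def_of_ne_zero h0, ← Complex.ofReal_log hh.le, neg_add, Real.exp_add, Real.exp_add,
    Real.exp_neg (Real.log h), Real.exp_log hh, Complex.ofReal_exp, ← Complex.exp_add,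
    ← Complex.exp_add, ← Complex.exp_add, Real.cosh_eq]
  congr 1
  have : (h ^ 2 * (Real.exp (-u) * h⁻¹) : ℝ) = h * Real.exp (-u) := by field_simp
  rw [this]
  push_cast
  ring

theorem tendsto_cpow_mul_macdonald {μ : ℂ} (hμ : 0 < μ.re) :
    Tendsto (fun h : ℝ => (h : ℂ) ^ μ * macdonald μ (2 * h)) (𝓝[>] 0)
      (𝓝 (Complex.Gamma μ / 2)) := by
  have hI := integrable_exp_sub_exp hμ
  have key : Tendsto (fun h : ℝ => ∫ v : ℝ, Complex.exp (μ * v - Real.exp v) *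
      Real.exp (-(h ^ 2 * Real.exp (-v)))) (𝓝[>] 0) (𝓝 (Complex.Gamma μ)) := by
    rw [← hI.2]
    refine tendsto_integral_filter_of_dominated_convergence
      (fun v => ‖Complex.exp (μ * v - Real.exp v)‖) (Eventually.of_forall fun h => ?_)
      (Eventually.of_forall fun h => Eventually.of_forall fun v => ?_) hI.1.norm
      (Eventually.of_forall fun v => ?_)
    · exact (by fun_prop : Continuous _).aestronglyMeasurable
    · rw [norm_mul]
      refine mul_le_of_le_one_right (norm_nonneg _) ?_
      rw [Complex.norm_real, Real.norm_eq_abs, Real.abs_exp]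
      exact Real.exp_le_one_iff.2 (neg_nonpos.2 (by positivity))
    · have hc : Continuous fun h : ℝ => Complex.exp (μ * v - Real.exp v) *
          (Real.exp (-(h ^ 2 * Real.exp (-v))) : ℂ) := by fun_prop
      have := hc.continuousAt (x := 0)
      simpa [ContinuousAt] using this.tendsto.mono_left nhdsWithin_le_nhds
  refine (key.div_const 2).congr' ?_
  filter_upwards [self_mem_nhdsWithin] with h hh
  exact (cpow_mul_macdonald_eq μ hh).symm

theorem tendsto_cpow_zero {μ : ℂ} (hμ : 0 < μ.re) :
    Tendsto (fun h : ℝ => (h : ℂ) ^ μ) (𝓝[>] 0) (𝓝 0) := by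
  rw [tendsto_zero_iff_norm_tendsto_zero]
  have h1 : Tendsto (fun h : ℝ => h ^ μ.re) (𝓝[>] 0) (𝓝 (0 ^ μ.re)) :=
    (Real.continuousAt_rpow_const 0 μ.re (Or.inr hμ.le)).tendsto.mono_left nhdsWithin_le_nhds
  rw [Real.zero_rpow hμ.ne'] at h1
  refine h1.congr' ?_
  filter_upwards [self_mem_nhdsWithin] with h hh
  exact (Complex.norm_cpow_eq_rpow_re_of_pos hh μ).symm

theorem tendsto_besselSeries_sq (ν : ℂ) :
    Tendsto (fun h : ℝ => besselSeries ν ((h : ℂ) ^ 2)) (𝓝[>] 0)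
      (𝓝 (Complex.Gamma (ν + 1))⁻¹) := by
  have hc : Continuous fun h : ℝ => besselSeries ν ((h : ℂ) ^ 2) :=
    (differentiable_besselSeries ν).continuous.comp (by fun_prop)
  have := (hc.continuousAt (x := 0)).tendsto.mono_left (nhdsWithin_le_nhds (s := Ioi 0))
  simpa [besselSeries_zero] using this

theorem tendsto_cpow_mul_besselSeries {ν : ℂ} (hν : ν.re = 0) :
    Tendsto (fun h : ℝ => 2 * ((h : ℂ) ^ (2 * ν + 2) * besselSeries (ν + 1) ((h : ℂ) ^ 2)))
      (𝓝[>] 0) (𝓝 0) := by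
  have h1 := tendsto_cpow_zero (μ := 2 * ν + 2) (by simp [hν])
  simpa using (h1.mul (tendsto_besselSeries_sq (ν + 1))).const_mul 2

theorem sin_pi_mul_ne_zero_of_re_eq_zero {ν : ℂ} (hν : ν ≠ 0) (hre : ν.re = 0) :
    Complex.sin (Real.pi * ν) ≠ 0 := by
  rw [Complex.sin_ne_zero_iff]
  intro k hk
  have hpi : (Real.pi : ℂ) ≠ 0 := by exact_mod_cast Real.pi_ne_zero
  have h1 : ν = k := mul_left_cancel₀ hpi (by rw [hk]; ring)
  rw [h1] at hre
  have : k = 0 := by exact_mod_cast hre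
  exact hν (by rw [h1, this]; simp)

/-- The Macdonald function of imaginary order in terms of the Bessel series, on the positive
half-line. -/
theorem macdonald_eq_besselSeries_ofReal {ν : ℂ} (hν : ν ≠ 0) (hre : ν.re = 0) {h : ℝ}
    (hh : 0 < h) :
    macdonald ν (2 * h) = Real.pi / (2 * Complex.sin (Real.pi * ν)) *
      ((h : ℂ) ^ (-ν) * besselSeries (-ν) ((h : ℂ) ^ 2) -
        (h : ℂ) ^ ν * besselSeries ν ((h : ℂ) ^ 2)) := by
  have hsin := sin_pi_mul_ne_zero_of_re_eq_zero hν hre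
  obtain ⟨c, hc⟩ : ∃ c : ℂ, c = Real.pi / (2 * Complex.sin (Real.pi * ν)) := ⟨_, rfl⟩
  -- By the reflection formula, the constant `c` is exactly the one that makes the limits of `a` and
  -- `b` at the origin cancel.
  have hG1 : Complex.Gamma (ν + 1) / 2 = -c * (Complex.Gamma (-ν))⁻¹ := by
    have := Complex.Gamma_mul_Gamma_one_sub (-ν)
    rw [sub_neg_eq_add, mul_neg, Complex.sin_neg, add_comm] at this
    have hne : Complex.Gamma (-ν) ≠ 0 := fun h0 => by
      rw [h0, zero_mul] at this
      exact div_ne_zero (by exact_mod_cast Real.pi_ne_zero) (neg_ne_zero.2 hsin) this.symm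
    rw [hc]
    field_simp at this ⊢
    linear_combination this
  have hG2 : Complex.Gamma (-ν + 1) / 2 = c * (Complex.Gamma ν)⁻¹ := by
    have := Complex.Gamma_mul_Gamma_one_sub ν
    rw [sub_eq_neg_add] at this
    have hne : Complex.Gamma ν ≠ 0 := fun h0 => by
      rw [h0, zero_mul] at this
      exact div_ne_zero (by exact_mod_cast Real.pi_ne_zero) hsin this.symm
    rw [hc]
    field_simp at this ⊢
    linear_combination this
  have key := eq_zero_of_bessel_system hν hre
    (u := fun h => macdonald ν (2 * h) - c * ((h : ℂ) ^ (-ν) * besselSeries (-ν) ((h : ℂ) ^ 2) -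
        (h : ℂ) ^ ν * besselSeries ν ((h : ℂ) ^ 2)))
    (a := fun h => -2 * ((h : ℂ) ^ (ν + 1) * macdonald (ν + 1) (2 * h)) -
      c * (2 * besselSeries (-ν - 1) ((h : ℂ) ^ 2) -
        2 * ((h : ℂ) ^ (2 * ν + 2) * besselSeries (ν + 1) ((h : ℂ) ^ 2))))
    (b := fun h => -2 * ((h : ℂ) ^ (-ν + 1) * macdonald (-ν + 1) (2 * h)) -
      c * (2 * ((h : ℂ) ^ (2 * -ν + 2) * besselSeries (-ν + 1) ((h : ℂ) ^ 2)) -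
        2 * besselSeries (ν - 1) ((h : ℂ) ^ 2)))
    (fun h hh => ?_) (fun h hh => ?_) (fun h hh => ?_) ?_ ?_ hh
  · rw [← hc]
    exact sub_eq_zero.1 key
  · refine ((hasDerivAt_cpow_mul_macdonald ν hh).sub (((hasDerivAt_besselSeries_sub_one (-ν) hh).sub
      (hasDerivAt_cpow_mul_besselSeries ν hh)).const_mul c)).congr_deriv ?_
    rw [sub_neg_eq_add, add_comm 1 ν]
    ring
  · refine ((hasDerivAt_cpow_mul_macdonald (-ν) hh).sub
      (((hasDerivAt_cpow_mul_besselSeries (-ν) hh).sub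
      (hasDerivAt_besselSeries_sub_one ν hh)).const_mul c)).congr_deriv ?_
    rw [macdonald_neg, neg_add_eq_sub]
    ring
  · have h1 := macdonald_three_term ν hh
    have h2 := besselSeries_three_term ν hh
    have h3 := besselSeries_three_term (-ν) hh
    rw [neg_neg] at h3
    linear_combination h1 + c * h2 + c * h3
  · have h1 := tendsto_cpow_mul_macdonald (μ := ν + 1) (by simp [hre])
    have h2 := tendsto_besselSeries_sq (-ν - 1)
    have h3 := (h1.const_mul (-2)).sub (((h2.const_mul 2).sub
      (tendsto_cpow_mul_besselSeries hre)).const_mul c)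
    convert h3 using 2
    rw [sub_add_cancel, hG1]
    ring
  · have h1 := tendsto_cpow_mul_macdonald (μ := -ν + 1) (by simp [hre])
    have h2 := tendsto_besselSeries_sq (ν - 1)
    have h3 := (h1.const_mul (-2)).sub (((tendsto_cpow_mul_besselSeries
      (ν := -ν) (by simp [hre])).sub (h2.const_mul 2)).const_mul c)
    convert h3 using 2
    rw [sub_add_cancel, hG2]
    ring

/-- The Macdonald function of imaginary order in terms of the Bessel series, on the right
half-plane. -/
theorem macdonald_eq_besselSeries {ν : ℂ} (hν : ν ≠ 0) (hre : ν.re = 0) {z : ℂ} (hz : 0 < z.re) :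
    macdonald ν z = Real.pi / (2 * Complex.sin (Real.pi * ν)) *
      ((z / 2) ^ (-ν) * besselSeries (-ν) ((z / 2) ^ 2) -
        (z / 2) ^ ν * besselSeries ν ((z / 2) ^ 2)) := by
  have hd : ∀ μ : ℂ, DifferentiableOn ℂ (fun z : ℂ => (z / 2) ^ μ * besselSeries μ ((z / 2) ^ 2))
      {z | 0 < z.re} := by
    intro μ z hz
    have hz' : 0 < z.re := hz
    have hs : z / 2 ∈ Complex.slitPlane := Or.inl (by simpa using hz')
    have h1 : DifferentiableAt ℂ (fun z : ℂ => (z / 2) ^ μ) z :=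
      (((hasDerivAt_id z).div_const 2).cpow_const hs).differentiableAt
    have h2 : DifferentiableAt ℂ (fun z : ℂ => besselSeries μ ((z / 2) ^ 2)) z :=
      (differentiable_besselSeries μ).differentiableAt.comp z (by fun_prop)
    exact (h1.mul h2).differentiableWithinAt
  refine eqOn_re_pos_of_eq_ofReal (differentiableOn_macdonald ν)
    (((hd (-ν)).sub (hd ν)).const_mul _) (fun r hr => ?_) hz
  have := macdonald_eq_besselSeries_ofReal hν hre (h := r / 2) (by positivity)
  simp only [Complex.ofReal_div, Complex.ofReal_ofNat, Pi.sub_apply] at this ⊢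
  rw [← this, mul_div_cancel₀ _ (two_ne_zero' ℂ)]

/-! ### The product formula on the imaginary axis -/

theorem continuous_macdonaldReal_mul_sqrt_cosh {y : ℝ} (hy : 0 < y) :
    Continuous fun w : ℝ => macdonaldReal (y * √(Real.cosh w)) := by
  rw [← continuousOn_univ]
  refine continuousOn_macdonaldReal.comp (by fun_prop) fun w _ => ?_
  have := Real.sqrt_pos.2 (Real.cosh_pos w)
  exact mul_pos hy this

/-- The norm bound for the kernel of the index transform, from the product formula. -/
theorem integrable_macdonaldReal_mul_sqrt_cosh {y : ℝ} (hy : 0 < y) :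
    Integrable (fun w : ℝ => macdonaldReal (y * √(Real.cosh w))) ∧
      ∫ w in Ioi (0 : ℝ), macdonaldReal (y * √(Real.cosh w)) ≤ macdonaldReal (y / 2) ^ 2 := by
  have hy2 : 0 < y / 2 := by positivity
  have hY : 0 < ((y / 2 : ℝ) : ℂ).re := hy2
  have hpos : ∀ w : ℝ, 0 < y * √((1 + Real.cosh w) / 2) := fun w => by
    have := Real.cosh_pos w
    positivity
  have hfun : ∀ w : ℝ, Complex.exp (0 * w) * macdonald 0 ((((y / 2 : ℝ) : ℂ) ^ 2 +
      ((y / 2 : ℝ) : ℂ) ^ 2 + 2 * ((y / 2 : ℝ) : ℂ) * ((y / 2 : ℝ) : ℂ) * Real.cosh w) ^ (2⁻¹ : ℂ))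
      = (macdonaldReal (y * √((1 + Real.cosh w) / 2)) : ℂ) := fun w => by
    have hc := Real.cosh_pos w
    have h1 : (((y / 2 : ℝ) : ℂ) ^ 2 + ((y / 2 : ℝ) : ℂ) ^ 2 +
        2 * ((y / 2 : ℝ) : ℂ) * ((y / 2 : ℝ) : ℂ) * Real.cosh w)
        = ((y * √((1 + Real.cosh w) / 2) : ℝ) : ℂ) ^ 2 := by
      rw [Complex.ofReal_mul, mul_pow, ← Complex.ofReal_pow (√_), Real.sq_sqrt (by positivity)]
      simp only [Complex.ofReal_div, Complex.ofReal_add,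
        Complex.ofReal_ofNat, Complex.ofReal_one]
      ring
    rw [h1, Complex.sq_cpow_two_inv (hpos w), macdonald_zero_ofReal, zero_mul, Complex.exp_zero,
      one_mul]
  have hI := integrable_macdonald_product hy2 hY 0
  have hP := macdonald_mul_macdonald hy2 hY 0
  simp only [hfun] at hI hP
  have hI' : Integrable fun w : ℝ => macdonaldReal (y * √((1 + Real.cosh w) / 2)) :=
    by simpa using hI.re
  rw [integral_complex_ofReal, macdonald_zero_ofReal] at hP
  have hP' : macdonaldReal (y / 2) * macdonaldReal (y / 2)
      = (∫ w : ℝ, macdonaldReal (y * √((1 + Real.cosh w) / 2))) / 2 := by exact_mod_cast hP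
  have hle : ∀ w : ℝ, macdonaldReal (y * √(Real.cosh w))
      ≤ macdonaldReal (y * √((1 + Real.cosh w) / 2)) := fun w => by
    refine macdonaldReal_anti (hpos w) ?_
    have := Real.one_le_cosh w
    gcongr
    linarith
  have hnn : ∀ w : ℝ, 0 ≤ macdonaldReal (y * √(Real.cosh w)) := fun w =>
    (macdonaldReal_pos (mul_pos hy (Real.sqrt_pos.2 (Real.cosh_pos w)))).le
  have hJ : Integrable fun w : ℝ => macdonaldReal (y * √(Real.cosh w)) := by
    refine hI'.mono' (continuous_macdonaldReal_mul_sqrt_cosh hy).aestronglyMeasurable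
      (Eventually.of_forall fun w => ?_)
    rw [Real.norm_of_nonneg (hnn w)]
    exact hle w
  refine ⟨hJ, ?_⟩
  have h2 := integral_eq_two_mul_integral_Ioi hJ (fun w => by rw [Real.cosh_neg])
  rw [smul_eq_mul] at h2
  have h3 := integral_mono hJ hI' hle
  rw [pow_two, hP']
  linarith

/-- `|K_0(z)| ≤ K_0(Re z)` and `Re √ζ = √((|ζ| + Re ζ)/2) ≥ √(Im ζ / 2)`. -/
theorem norm_macdonald_sqrt_le {y : ℝ} (hy : 0 < y) (w : ℝ) {ζ : ℂ} (hre : 0 ≤ ζ.re)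
    (him : 2 * y ^ 2 * Real.cosh w ≤ ζ.im) :
    ‖macdonald 0 (ζ ^ (2⁻¹ : ℂ))‖ ≤ macdonaldReal (y * √(Real.cosh w)) := by
  refine (norm_macdonald_zero_le _).trans
    (macdonaldReal_anti (mul_pos hy (Real.sqrt_pos.2 (Real.cosh_pos w))) ?_)
  rw [Complex.cpow_inv_two_re]
  have h1 : y * √(Real.cosh w) = √(y ^ 2 * Real.cosh w) := by
    rw [Real.sqrt_mul (by positivity), Real.sqrt_sq hy.le]
  rw [h1]
  apply Real.sqrt_le_sqrt
  have h2 := Complex.im_le_norm ζ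
  linarith

/-- The Macdonald function `K_{iτ}(i y)`, through its expression by Bessel functions. -/
noncomputable def macdonaldImag (ν : ℂ) (y : ℝ) : ℂ :=
  Real.pi / (2 * Complex.sin (Real.pi * ν)) *
      ((Complex.I * y / 2) ^ (-ν) * besselSeries (-ν) ((Complex.I * y / 2) ^ 2) -
        (Complex.I * y / 2) ^ ν * besselSeries ν ((Complex.I * y / 2) ^ 2))

/-- The defining integral is not absolutely convergent at `iy`, but the series expression is
continuous there, since `iy` lies off the cut. -/
theorem tendsto_macdonald_imag {ν : ℂ} (hν : ν ≠ 0) (hre : ν.re = 0) {y : ℝ} (hy : 0 < y) :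
    Tendsto (fun ε : ℝ => macdonald ν (ε + Complex.I * y)) (𝓝[>] 0) (𝓝 (macdonaldImag ν y)) := by
  have hc : ∀ μ : ℂ, Tendsto (fun ε : ℝ => ((ε + Complex.I * y) / 2) ^ μ *
      besselSeries μ (((ε + Complex.I * y) / 2) ^ 2)) (𝓝[>] 0)
      (𝓝 ((Complex.I * y / 2) ^ μ * besselSeries μ ((Complex.I * y / 2) ^ 2))) := by
    intro μ
    have h0 : ContinuousAt (fun ε : ℝ => ((ε : ℂ) + Complex.I * y) / 2) 0 := by fun_prop
    have h1 : ContinuousAt (fun ε : ℝ => (((ε : ℂ) + Complex.I * y) / 2) ^ μ) 0 :=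
      ContinuousAt.comp (g := fun z : ℂ => z ^ μ)
        (continuousAt_cpow_const (Or.inr (by simp [hy.ne']))) h0
    have h2 : ContinuousAt (fun ε : ℝ => besselSeries μ (((ε + Complex.I * y) / 2) ^ 2)) 0 :=
      (differentiable_besselSeries μ).continuous.continuousAt.comp (h0.pow 2)
    simpa using (h1.tendsto.mul h2.tendsto).mono_left nhdsWithin_le_nhds
  refine (((hc (-ν)).sub (hc ν)).const_mul
    (Real.pi / (2 * Complex.sin (Real.pi * ν)))).congr' ?_
  filter_upwards [self_mem_nhdsWithin] with ε hε
  exact (macdonald_eq_besselSeries hν hre (by simpa using hε)).symm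

/-- With `X = y` and `Y = ε + iy`, the number under the root has nonnegative real part and imaginary
part at least `2y² cosh w`. So `K_0(y √cosh w)` dominates the integrand for all `ε > 0` at once. -/
theorem macdonald_mul_macdonaldImag {ν : ℂ} (hν : ν ≠ 0) (hre : ν.re = 0) {y : ℝ} (hy : 0 < y) :
    macdonald ν y * macdonaldImag ν y = (∫ w : ℝ, Complex.exp (ν * w) *
      macdonald 0 ((2 * Complex.I * y ^ 2 * Real.cosh w) ^ (2⁻¹ : ℂ))) / 2 := by
  have hlhs := (tendsto_macdonald_imag hν hre hy).const_mul (macdonald ν y)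
  refine tendsto_nhds_unique hlhs ?_
  have hζre : ∀ ε w : ℝ, ((ε + Complex.I * y) ^ 2 + y ^ 2 + 2 * y * (ε + Complex.I * y) *
      Real.cosh w : ℂ).re = ε ^ 2 + 2 * y * ε * Real.cosh w := fun ε w => by
    simp only [pow_two, Complex.add_re, Complex.add_im, Complex.mul_im, Complex.mul_re,
      Complex.ofReal_re, Complex.ofReal_im, Complex.re_ofNat, Complex.im_ofNat, Complex.I_re,
      Complex.I_im]
    ring
  have hζim : ∀ ε w : ℝ, ((ε + Complex.I * y) ^ 2 + y ^ 2 + 2 * y * (ε + Complex.I * y) *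
      Real.cosh w : ℂ).im = 2 * y * ε + 2 * y ^ 2 * Real.cosh w := fun ε w => by
    simp only [pow_two, Complex.add_re, Complex.add_im, Complex.mul_im, Complex.mul_re,
      Complex.ofReal_re, Complex.ofReal_im, Complex.re_ofNat, Complex.im_ofNat, Complex.I_re,
      Complex.I_im]
    ring
  have hrhs : Tendsto (fun ε : ℝ => ∫ w : ℝ, Complex.exp (ν * w) *
      macdonald 0 (((ε + Complex.I * y) ^ 2 + y ^ 2 + 2 * y * (ε + Complex.I * y) *
        Real.cosh w) ^ (2⁻¹ : ℂ))) (𝓝[>] 0) (𝓝 (∫ w : ℝ, Complex.exp (ν * w) *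
      macdonald 0 ((2 * Complex.I * y ^ 2 * Real.cosh w) ^ (2⁻¹ : ℂ)))) := by
    refine tendsto_integral_filter_of_dominated_convergence
      (fun w => macdonaldReal (y * √(Real.cosh w))) ?_ ?_
      (integrable_macdonaldReal_mul_sqrt_cosh hy).1 (Eventually.of_forall fun w => ?_)
    · filter_upwards [self_mem_nhdsWithin] with ε hε
      have hε' : 0 < ε := hε
      exact (integrable_macdonald_product hy (Y := ε + Complex.I * y)
        (by simpa using hε') ν).aestronglyMeasurable
    · filter_upwards [self_mem_nhdsWithin] with ε hε
      have hε' : 0 < ε := hε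
      refine Eventually.of_forall fun w => ?_
      have hc := Real.cosh_pos w
      rw [norm_mul, Complex.norm_exp]
      simp only [Complex.mul_re, hre, Complex.ofReal_im, zero_mul, mul_zero, sub_self,
        Real.exp_zero, one_mul]
      refine norm_macdonald_sqrt_le hy w ?_ ?_
      · rw [hζre]; positivity
      · rw [hζim]
        have : 0 < 2 * y * ε := by positivity
        linarith
    · have hmem : ((((0 : ℝ) : ℂ) + Complex.I * y) ^ 2 + y ^ 2 + 2 * y *
          (((0 : ℝ) : ℂ) + Complex.I * y) * Real.cosh w) ∈ Complex.slitPlane := by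
        right
        rw [hζim]
        have := Real.cosh_pos w
        positivity
      have hcont : ContinuousAt (fun ε : ℝ => Complex.exp (ν * w) * macdonald 0
          (((ε + Complex.I * y) ^ 2 + y ^ 2 + 2 * y * (ε + Complex.I * y) *
            Real.cosh w) ^ (2⁻¹ : ℂ))) 0 := by
        refine continuousAt_const.mul ?_
        refine ContinuousAt.comp (g := fun ζ : ℂ => macdonald 0 (ζ ^ (2⁻¹ : ℂ)))
          (f := fun ε : ℝ => ((ε + Complex.I * y) ^ 2 + y ^ 2 + 2 * y * (ε + Complex.I * y) *
            Real.cosh w : ℂ)) ?_ (by fun_prop)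
        exact differentiableOn_macdonald_sqrt.continuousOn.continuousAt
          (Complex.isOpen_slitPlane.mem_nhds hmem)
      have := hcont.tendsto.mono_left (nhdsWithin_le_nhds (s := Ioi 0))
      convert this using 6
      rw [Complex.ofReal_zero]
      linear_combination (-(y : ℂ) ^ 2) * Complex.I_sq
  refine (hrhs.div_const 2).congr' ?_
  filter_upwards [self_mem_nhdsWithin] with ε hε
  have hε' : 0 < ε := hε
  exact (macdonald_mul_macdonald hy (Y := ε + Complex.I * y) (by simpa using hε') ν).symm

/-! ### The real part of `K_{iτ}(iy)` -/

theorem conj_besselJ_ofReal (ν : ℂ) {y : ℝ} (hy : 0 < y) :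
    (starRingEnd ℂ) (besselJ ν y) = besselJ ((starRingEnd ℂ) ν) y := by
  have hy2 : (y : ℂ) / 2 = ((y / 2 : ℝ) : ℂ) := by push_cast; rfl
  have harg : ((y / 2 : ℝ) : ℂ).arg ≠ Real.pi := by
    rw [Complex.arg_ofReal_of_nonneg (by positivity)]
    exact Real.pi_ne_zero.symm
  unfold besselJ
  rw [hy2, map_mul, Complex.conj_tsum, Complex.cpow_conj _ _ harg, Complex.conj_ofReal]
  congr 2
  ext k
  simp only [map_mul, map_div₀, map_pow, map_neg, map_one, Complex.conj_natCast,
    ← Complex.Gamma_conj, map_add, Complex.conj_ofReal]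

theorem I_mul_cpow {τ y : ℝ} (hy : 0 < y) :
    (Complex.I * y / 2) ^ (Complex.I * τ) =
      Real.exp (-(Real.pi * τ / 2)) * ((y : ℂ) / 2) ^ (Complex.I * τ) := by
  have h2 : (0 : ℝ) < y / 2 := by positivity
  have h0 : ((y / 2 : ℝ) : ℂ) ≠ 0 := by exact_mod_cast h2.ne'
  rw [show Complex.I * y / 2 = ((y / 2 : ℝ) : ℂ) * Complex.I by push_cast; ring,
    show (y : ℂ) / 2 = ((y / 2 : ℝ) : ℂ) by push_cast; rfl,
    Complex.cpow_def_of_ne_zero (mul_ne_zero h0 Complex.I_ne_zero),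
    Complex.cpow_def_of_ne_zero h0, Complex.log_ofReal_mul h2 Complex.I_ne_zero, Complex.log_I,
    Complex.ofReal_exp, ← Complex.exp_add, ← Complex.ofReal_log h2.le]
  congr 1
  push_cast
  linear_combination (Real.pi * τ / 2 : ℂ) * Complex.I_sq

/-- With `a = πτ/2` and `J = J_{iτ}(y)`, the value is `π / (2i sinh 2a) · (e^a conj J - e^{-a} J)`.
Its real part carries `2 cosh a · Im J`, and `sinh 2a = 2 sinh a cosh a` cancels the `cosh a`. -/
theorem re_macdonaldImag {τ : ℝ} (hτ : τ ≠ 0) {y : ℝ} (hy : 0 < y) :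
    (macdonaldImag (Complex.I * τ) y).re =
      -(Real.pi / 2) * (besselJ (Complex.I * τ) y).im / Real.sinh (Real.pi * τ / 2) := by
  have hneg : -(Complex.I * (τ : ℂ)) = Complex.I * ((-τ : ℝ) : ℂ) := by push_cast; ring
  have hconj : (starRingEnd ℂ) (Complex.I * (τ : ℂ)) = Complex.I * ((-τ : ℝ) : ℂ) := by
    rw [map_mul, Complex.conj_I, Complex.conj_ofReal]; push_cast; ring
  have hsq : (Complex.I * (y : ℂ) / 2) ^ 2 = -((y : ℂ) / 2) ^ 2 := by
    linear_combination ((y : ℂ) / 2) ^ 2 * Complex.I_sq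
  obtain ⟨a, ha⟩ : ∃ a, a = Real.pi * τ / 2 := ⟨_, rfl⟩
  have hsin : Complex.sin (Real.pi * (Complex.I * τ)) = (Real.sinh (2 * a) : ℂ) * Complex.I := by
    rw [Complex.ofReal_sinh, ← Complex.sin_mul_I, ha]
    congr 1
    push_cast
    ring
  have hJ : macdonaldImag (Complex.I * τ) y = Real.pi / (2 * (Real.sinh (2 * a) * Complex.I)) *
      (Real.exp a * (starRingEnd ℂ) (besselJ (Complex.I * τ) y)
        - Real.exp (-a) * besselJ (Complex.I * τ) y) := by
    rw [conj_besselJ_ofReal _ hy, hconj, besselJ_eq, besselJ_eq]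
    unfold macdonaldImag
    rw [hsin, hneg, I_mul_cpow hy, I_mul_cpow hy, hsq, ha]
    simp only [mul_neg, neg_div, neg_neg]
    ring
  have hsa : Real.sinh a ≠ 0 := by
    rw [Ne, Real.sinh_eq_zero, ha]
    exact div_ne_zero (mul_ne_zero Real.pi_ne_zero hτ) two_ne_zero
  have hca : Real.cosh a ≠ 0 := (Real.cosh_pos a).ne'
  have hs2 : Real.sinh (2 * a) ≠ 0 := by
    rw [Real.sinh_two_mul]
    exact mul_ne_zero (mul_ne_zero two_ne_zero hsa) hca
  obtain ⟨J, hJd⟩ : ∃ J, J = besselJ (Complex.I * τ) y := ⟨_, rfl⟩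
  rw [hJ, ← ha, ← hJd]
  have h1 : (Real.pi / (2 * (Real.sinh (2 * a) * Complex.I)) : ℂ)
      = ((Real.pi / (2 * Real.sinh (2 * a)) : ℝ) : ℂ) * -Complex.I := by
    rw [Complex.ofReal_div, Complex.ofReal_mul, Complex.ofReal_ofNat]
    have : (Real.sinh (2 * a) : ℂ) ≠ 0 := by exact_mod_cast hs2
    have hI := Complex.I_ne_zero
    field_simp
    rw [Complex.I_sq, neg_neg]
  rw [h1, mul_assoc, Complex.re_ofReal_mul]
  simp only [Complex.neg_re, Complex.mul_re, Complex.sub_re, Complex.sub_im, Complex.mul_im,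
    Complex.ofReal_re, Complex.ofReal_im, Complex.conj_re, Complex.conj_im, Complex.I_re,
    Complex.I_im, Complex.neg_im]
  have hexp : Real.exp a + Real.exp (-a) = 2 * Real.cosh a := by rw [Real.cosh_eq]; ring
  rw [Real.sinh_two_mul] at hs2 ⊢
  field_simp
  linear_combination (-J.im) * hexp

/-! ### The Meijer kernel and its bounds by the weight -/

theorem exp_pi_mul_I_div_four_sq : Complex.exp (Real.pi * Complex.I / 4) ^ 2 = Complex.I := by
  rw [← Complex.exp_nat_mul, show ((2 : ℕ) : ℂ) * (Real.pi * Complex.I / 4) = Real.pi / 2 * Complex.I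
    by push_cast; ring, Complex.exp_pi_div_two_mul_I]

theorem exp_pi_mul_I_div_four_re_pos : 0 < (Complex.exp (Real.pi * Complex.I / 4)).re := by
  rw [show (Real.pi * Complex.I / 4 : ℂ) = ((Real.pi / 4 : ℝ) : ℂ) * Complex.I by push_cast; ring,
    Complex.exp_ofReal_mul_I_re]
  apply Real.cos_pos_of_mem_Ioo
  constructor <;> linarith [Real.pi_pos]

theorem meijerKernel_argument_re_pos {x t : ℝ} (hxt : 0 < x * t) :
    0 < (4 * Complex.exp (Real.pi * Complex.I / 4) * (√(x * t) : ℂ)).re := by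
  have h := exp_pi_mul_I_div_four_re_pos
  have hs := Real.sqrt_pos.2 hxt
  rw [mul_assoc, show (4 : ℂ) = ((4 : ℝ) : ℂ) by norm_num, Complex.re_ofReal_mul,
    Complex.re_mul_ofReal]
  positivity

theorem besselK_meijer_eq {x : ℝ} (hx : 0 < x) (w : ℝ) :
    besselK 0 (4 * Complex.exp (Real.pi * Complex.I / 4) * (√(Real.cosh w * x) : ℂ)) =
      macdonald 0 ((2 * Complex.I * ((2 * √(2 * x) : ℝ) : ℂ) ^ 2 * Real.cosh w) ^ (2⁻¹ : ℂ)) := by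
  have hc := Real.cosh_pos w
  have hre := meijerKernel_argument_re_pos (mul_pos hc hx)
  rw [besselK_eq_macdonald _ hre]
  have h1 : (√(2 * x) : ℂ) ^ 2 = 2 * x := by
    rw [← Complex.ofReal_pow, Real.sq_sqrt (by positivity)]
    push_cast; rfl
  have h2 : (√(Real.cosh w * x) : ℂ) ^ 2 = Real.cosh w * x := by
    rw [← Complex.ofReal_pow, Real.sq_sqrt (by positivity), Complex.ofReal_mul]
  have h3 : 2 * Complex.I * ((2 * √(2 * x) : ℝ) : ℂ) ^ 2 * Real.cosh w =
      (4 * Complex.exp (Real.pi * Complex.I / 4) * (√(Real.cosh w * x) : ℂ)) ^ 2 := by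
    rw [mul_pow, mul_pow, exp_pi_mul_I_div_four_sq, h2, Complex.ofReal_mul, mul_pow, h1,
      Complex.ofReal_ofNat]
    ring
  rw [h3, Complex.sq_cpow_two_inv hre]

theorem abs_meijerKernel_le {x : ℝ} (hx : 0 < x) (w : ℝ) :
    |meijerKernel (Real.cosh w) x| ≤ macdonaldReal (2 * √(2 * x) * √(Real.cosh w)) := by
  have hs : 0 < 2 * √(2 * x) := by positivity
  unfold meijerKernel
  rw [besselK_meijer_eq hx]
  refine (Complex.abs_re_le_norm _).trans (norm_macdonald_sqrt_le hs w ?_ ?_) <;>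
  · rw [← Complex.ofReal_pow]
    simp only [Complex.mul_re, Complex.mul_im, Complex.ofReal_re, Complex.ofReal_im, Complex.I_re,
      Complex.I_im, Complex.re_ofNat, Complex.im_ofNat]
    ring_nf
    exact le_rfl

theorem continuousOn_meijerKernel_cosh :
    ContinuousOn (fun p : ℝ × ℝ => meijerKernel (Real.cosh p.1) p.2) (univ ×ˢ Ioi 0) := by
  unfold meijerKernel
  refine Complex.continuous_re.comp_continuousOn ?_
  have h1 : ContinuousOn (fun p : ℝ × ℝ => macdonald 0
      (4 * Complex.exp (Real.pi * Complex.I / 4) * (√(Real.cosh p.1 * p.2) : ℂ)))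
      (univ ×ˢ Ioi 0) := by
    refine (differentiableOn_macdonald 0).continuousOn.comp (by fun_prop) fun p hp => ?_
    exact meijerKernel_argument_re_pos (mul_pos (Real.cosh_pos _) hp.2)
  refine h1.congr fun p hp => ?_
  exact besselK_eq_macdonald _ (meijerKernel_argument_re_pos (mul_pos (Real.cosh_pos _) hp.2))

theorem aestronglyMeasurable_meijerKernel_cosh :
    AEStronglyMeasurable (fun p : ℝ × ℝ => meijerKernel (Real.cosh p.1) p.2)
      ((volume.restrict (Ioi 0)).prod (volume.restrict (Ioi 0))) := by
  rw [Measure.prod_restrict]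
  exact (continuousOn_meijerKernel_cosh.mono (prod_mono (subset_univ _) subset_rfl)).aestronglyMeasurable
    (measurableSet_Ioi.prod measurableSet_Ioi)

theorem continuous_meijerKernel_cosh {x : ℝ} (hx : 0 < x) :
    Continuous fun t : ℝ => meijerKernel (Real.cosh t) x :=
  continuousOn_meijerKernel_cosh.comp_continuous (f := fun t : ℝ => (t, x)) (by fun_prop)
    fun _ => ⟨mem_univ _, hx⟩

theorem integrable_meijerKernel_cosh {x : ℝ} (hx : 0 < x) :
    Integrable fun t : ℝ => meijerKernel (Real.cosh t) x :=
  (integrable_macdonaldReal_mul_sqrt_cosh (y := 2 * √(2 * x)) (by positivity)).1.mono'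
    (continuous_meijerKernel_cosh hx).aestronglyMeasurable
    (Eventually.of_forall fun t => abs_meijerKernel_le hx t)

/-- The weight `K_0(√(2x))²`. -/
noncomputable def macdonaldWeight (x : ℝ) : ℝ := macdonaldReal (√(2 * x)) ^ 2

theorem macdonaldWeight_pos {x : ℝ} (hx : 0 < x) : 0 < macdonaldWeight x :=
  pow_pos (macdonaldReal_pos (by positivity)) 2

theorem integral_macdonaldReal_le_weight {x : ℝ} (hx : 0 < x) :
    ∫ w in Ioi (0 : ℝ), macdonaldReal (2 * √(2 * x) * √(Real.cosh w)) ≤ macdonaldWeight x := by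
  have := (integrable_macdonaldReal_mul_sqrt_cosh (y := 2 * √(2 * x)) (by positivity)).2
  rwa [mul_div_cancel_left₀ _ (two_ne_zero' ℝ)] at this

theorem integral_abs_meijerKernel_le {x : ℝ} (hx : 0 < x) :
    ∫ w in Ioi (0 : ℝ), |meijerKernel (Real.cosh w) x| ≤ macdonaldWeight x :=
  (integral_mono (integrable_meijerKernel_cosh hx).abs.integrableOn
    (integrable_macdonaldReal_mul_sqrt_cosh (y := 2 * √(2 * x)) (by positivity)).1.integrableOn
    fun w => abs_meijerKernel_le hx w).trans (integral_macdonaldReal_le_weight hx)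

/-- The majorant `K_0(y √cosh w)` decreases in `w > 0`, so `t` times its value at `t` is at most its
integral over `(0, t]`. This gives convergence of `𝒦₀ f` at every point `cosh t`, not just almost
everywhere. -/
theorem mul_abs_meijerKernel_le_weight {x t : ℝ} (hx : 0 < x) (ht : 0 < t) :
    t * |meijerKernel (Real.cosh t) x| ≤ macdonaldWeight x := by
  have hs : 0 < 2 * √(2 * x) := by positivity
  have hI := (integrable_macdonaldReal_mul_sqrt_cosh hs).1
  have hnn : ∀ w : ℝ, 0 < macdonaldReal (2 * √(2 * x) * √(Real.cosh w)) := fun w =>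
    macdonaldReal_pos (mul_pos hs (Real.sqrt_pos.2 (Real.cosh_pos w)))
  calc t * |meijerKernel (Real.cosh t) x|
      ≤ t * macdonaldReal (2 * √(2 * x) * √(Real.cosh t)) := by
        gcongr
        exact abs_meijerKernel_le hx t
    _ = ∫ _ in Ioc 0 t, macdonaldReal (2 * √(2 * x) * √(Real.cosh t)) := by
        simp [ht.le]
    _ ≤ ∫ w in Ioc 0 t, macdonaldReal (2 * √(2 * x) * √(Real.cosh w)) := by
        refine setIntegral_mono_on (by simp) hI.integrableOn measurableSet_Ioc fun w hw => ?_
        refine macdonaldReal_anti (mul_pos hs (Real.sqrt_pos.2 (Real.cosh_pos w))) ?_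
        have : Real.cosh w ≤ Real.cosh t := by
          rw [Real.cosh_le_cosh, abs_of_pos hw.1, abs_of_pos ht]
          exact hw.2
        gcongr
    _ ≤ ∫ w in Ioi (0 : ℝ), macdonaldReal (2 * √(2 * x) * √(Real.cosh w)) :=
        setIntegral_mono_set hI.integrableOn (Eventually.of_forall fun w => (hnn w).le)
          (Ioc_subset_Ioi_self.eventuallyLE)
    _ ≤ _ := integral_macdonaldReal_le_weight hx

/-! ### The index kernel as a cosine transform -/

theorem besselK_I_mul_eq_ofReal (τ y : ℝ) :
    besselK (Complex.I * τ) y =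
      ((∫ u in Ioi (0 : ℝ), Real.exp (-y * Real.cosh u) * Real.cos (τ * u) : ℝ) : ℂ) := by
  unfold besselK
  rw [← integral_complex_ofReal]
  congr 1
  ext u
  rw [Complex.ofReal_mul, Complex.ofReal_exp, Complex.ofReal_cos,
    show Complex.I * (τ : ℂ) * u = ((τ * u : ℝ) : ℂ) * Complex.I by push_cast; ring,
    Complex.cosh_mul_I, Complex.ofReal_mul (-y), Complex.ofReal_neg]

/-- The kernel of the index transform is a Fourier cosine transform. -/
theorem indexKernel_eq_integral {τ x : ℝ} (hτ : τ ≠ 0) (hx : 0 < x) :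
    indexKernel τ x = ((-(2 / Real.pi) *
      ∫ w in Ioi (0 : ℝ), meijerKernel (Real.cosh w) x * Real.cos (τ * w) : ℝ) : ℂ) := by
  obtain ⟨y, hyd⟩ : ∃ y, y = 2 * √(2 * x) := ⟨_, rfl⟩
  have hy : 0 < y := by rw [hyd]; positivity
  have hν : Complex.I * (τ : ℂ) ≠ 0 := mul_ne_zero Complex.I_ne_zero (by exact_mod_cast hτ)
  have hνre : (Complex.I * (τ : ℂ)).re = 0 := by simp
  obtain ⟨k, hk⟩ : ∃ k : ℝ → ℂ, k = fun w : ℝ =>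
      macdonald 0 ((2 * Complex.I * (y : ℂ) ^ 2 * Real.cosh w) ^ (2⁻¹ : ℂ)) := ⟨_, rfl⟩
  have hkre : ∀ w, (k w).re = meijerKernel (Real.cosh w) x := fun w => by
    unfold meijerKernel
    rw [besselK_meijer_eq hx, hk, hyd]
  have hkeven : ∀ w, k (-w) = k w := fun w => by simp only [hk, Real.cosh_neg]
  have hkle : ∀ w, ‖k w‖ ≤ macdonaldReal (y * √(Real.cosh w)) := fun w => by
    rw [hk]
    refine norm_macdonald_sqrt_le hy w ?_ ?_ <;>
    · rw [← Complex.ofReal_pow]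
      simp only [Complex.mul_re, Complex.mul_im, Complex.ofReal_re, Complex.ofReal_im,
        Complex.I_re, Complex.I_im, Complex.re_ofNat, Complex.im_ofNat]
      ring_nf
      exact le_rfl
  have hkc : Continuous k := by
    rw [hk]
    refine differentiableOn_macdonald_sqrt.continuousOn.comp_continuous
      (f := fun w : ℝ => 2 * Complex.I * (y : ℂ) ^ 2 * Real.cosh w) (by fun_prop) fun w => ?_
    right
    rw [← Complex.ofReal_pow]
    simp only [Complex.mul_re, Complex.mul_im, Complex.ofReal_re, Complex.ofReal_im,
      Complex.I_re, Complex.I_im, Complex.re_ofNat, Complex.im_ofNat]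
    have := Real.cosh_pos w
    ring_nf
    positivity
  have hB := (integrable_macdonaldReal_mul_sqrt_cosh hy).1
  have hint : ∀ s : ℝ, Integrable fun w : ℝ => Complex.exp (Complex.I * s * w) * k w := fun s => by
    refine hB.mono' (by fun_prop : Continuous _).aestronglyMeasurable
      (Eventually.of_forall fun w => ?_)
    rw [norm_mul, show Complex.I * (s : ℂ) * w = ((s * w : ℝ) : ℂ) * Complex.I by push_cast; ring,
      Complex.norm_exp_ofReal_mul_I, one_mul]
    exact hkle w
  have hcos : Integrable fun w : ℝ => (Real.cos (τ * w) : ℂ) * k w := by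
    refine hB.mono' (by fun_prop : Continuous _).aestronglyMeasurable
      (Eventually.of_forall fun w => ?_)
    rw [norm_mul, Complex.norm_real]
    exact (mul_le_of_le_one_left (norm_nonneg _) (Real.abs_cos_le_one _)).trans (hkle w)
  have hswap : ∫ w : ℝ, Complex.exp (Complex.I * τ * w) * k w =
      ∫ w : ℝ, (Real.cos (τ * w) : ℂ) * k w := by
    have h1 : ∫ w : ℝ, Complex.exp (Complex.I * τ * w) * k w
        = ∫ w : ℝ, Complex.exp (Complex.I * (-τ : ℝ) * w) * k w := by
      rw [← integral_neg_eq_self]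
      congr 1
      ext w
      rw [hkeven]
      push_cast
      ring_nf
    have h2 : ∫ w : ℝ, (Real.cos (τ * w) : ℂ) * k w =
        (∫ w : ℝ, (Complex.exp (Complex.I * τ * w) * k w +
          Complex.exp (Complex.I * (-τ : ℝ) * w) * k w)) / 2 := by
      rw [← integral_div]
      congr 1
      ext w
      rw [Complex.ofReal_cos, Complex.cos]
      push_cast
      ring_nf
    rw [h2, integral_add (hint τ) (hint (-τ)), ← h1]
    ring
  have hprod := macdonald_mul_macdonaldImag hν hνre hy
  have hke : ∫ w : ℝ, Complex.exp (Complex.I * τ * w) *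
      macdonald 0 ((2 * Complex.I * (y : ℂ) ^ 2 * Real.cosh w) ^ (2⁻¹ : ℂ)) =
      ∫ w : ℝ, Complex.exp (Complex.I * τ * w) * k w := by rw [hk]
  rw [hke, hswap, integral_eq_two_mul_integral_Ioi hcos (fun w => by
    rw [hkeven, mul_neg, Real.cos_neg]), ← besselK_eq_macdonald _ (by simpa using hy)] at hprod
  have hreal := besselK_I_mul_eq_ofReal τ y
  -- Because this factor is real, taking real parts in the product formula isolates `Re K_{iτ}(iy)`.
  obtain ⟨r, hr⟩ : ∃ r : ℝ, besselK (Complex.I * τ) y = r := ⟨_, hreal⟩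
  rw [hr] at hprod
  have hre := congrArg Complex.re hprod
  rw [Complex.re_ofReal_mul, re_macdonaldImag hτ hy, Complex.real_smul, Complex.ofReal_ofNat,
    mul_div_cancel_left₀ _ (two_ne_zero' ℂ)] at hre
  have hint_re : (∫ w in Ioi (0 : ℝ), (Real.cos (τ * w) : ℂ) * k w).re
      = ∫ w in Ioi (0 : ℝ), meijerKernel (Real.cosh w) x * Real.cos (τ * w) := by
    have := integral_re (𝕜 := ℂ) (hcos.integrableOn (s := Ioi (0 : ℝ)))
    simp only [RCLike.re_eq_complex_re] at this
    rw [← this]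
    congr 1
    ext w
    rw [Complex.re_ofReal_mul, hkre, mul_comm]
  rw [hint_re] at hre
  unfold indexKernel
  rw [← hyd, hr, ← hre]
  push_cast
  have hpi : (Real.pi : ℂ) ≠ 0 := by exact_mod_cast Real.pi_ne_zero
  field_simp

theorem norm_indexKernel_le {τ x : ℝ} (hτ : τ ≠ 0) (hx : 0 < x) :
    ‖indexKernel τ x‖ ≤ 2 / Real.pi * macdonaldWeight x := by
  rw [indexKernel_eq_integral hτ hx, Complex.norm_real, norm_mul, norm_neg,
    Real.norm_of_nonneg (by positivity)]
  gcongr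
  refine (norm_integral_le_of_norm_le (integrable_meijerKernel_cosh hx).abs.integrableOn
    (Eventually.of_forall fun w => ?_)).trans (integral_abs_meijerKernel_le hx)
  rw [norm_mul]
  exact mul_le_of_le_one_right (norm_nonneg _) (Real.abs_cos_le_one _)

/-- Measurability in `x` is read off the integral representation, so no regularity of `J` is
required. -/
theorem aestronglyMeasurable_indexKernel {τ : ℝ} (hτ : τ ≠ 0) :
    AEStronglyMeasurable (indexKernel τ) (volume.restrict (Ioi 0)) := by
  have h1 : AEStronglyMeasurable (fun p : ℝ × ℝ => meijerKernel (Real.cosh p.1) p.2 *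
      Real.cos (τ * p.1)) ((volume.restrict (Ioi 0)).prod (volume.restrict (Ioi 0))) :=
    aestronglyMeasurable_meijerKernel_cosh.mul
      (by fun_prop : Continuous fun p : ℝ × ℝ => Real.cos (τ * p.1)).aestronglyMeasurable
  have h2 := h1.prod_swap.integral_prod_right'
  refine (Complex.continuous_ofReal.comp_aestronglyMeasurable
    (h2.const_mul (-(2 / Real.pi)))).congr ?_
  filter_upwards [ae_restrict_mem measurableSet_Ioi] with x hx
  exact (indexKernel_eq_integral hτ hx).symm

/-! ### The cosine transform of an integrable function -/

theorem norm_fourierCosine_integrand (g : ℝ → ℂ) (τ t : ℝ) :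
    ‖g t * (Real.cos (τ * t) : ℂ)‖ ≤ ‖g t‖ := by
  rw [norm_mul, Complex.norm_real]
  exact mul_le_of_le_one_right (norm_nonneg _) (Real.abs_cos_le_one _)

theorem integrableOn_mul_cos {g : ℝ → ℂ} (hg : IntegrableOn g (Ioi 0)) (τ : ℝ) :
    IntegrableOn (fun t => g t * (Real.cos (τ * t) : ℂ)) (Ioi 0) :=
  hg.norm.mono' (hg.aestronglyMeasurable.mul
    (by fun_prop : Continuous fun t : ℝ => (Real.cos (τ * t) : ℂ)).aestronglyMeasurable)
    (Eventually.of_forall fun t => norm_fourierCosine_integrand g τ t)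

theorem continuous_fourierCosine {g : ℝ → ℂ} (hg : IntegrableOn g (Ioi 0)) :
    Continuous (fourierCosine g) := by
  unfold fourierCosine
  refine continuous_const.mul (continuous_of_dominated
    (fun τ => (integrableOn_mul_cos hg τ).aestronglyMeasurable)
    (fun τ => Eventually.of_forall fun t => norm_fourierCosine_integrand g τ t) hg.norm
    (Eventually.of_forall fun t => by fun_prop))

/-- The Riemann–Lebesgue lemma for the cosine transform. -/
theorem tendsto_fourierCosine_cocompact {g : ℝ → ℂ} (hg : IntegrableOn g (Ioi 0)) :
    Tendsto (fourierCosine g) (cocompact ℝ) (𝓝 0) := by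
  have hpi := Real.pi_ne_zero
  -- `Real.fourierChar` contains the factor `2π`, hence the rescaled frequency.
  have hexp : ∀ s v : ℝ, Real.fourierChar (-(v * (s / (2 * Real.pi)))) • (Ioi (0 : ℝ)).indicator g v
      = (Ioi (0 : ℝ)).indicator (fun v => Complex.exp (-(s * v : ℝ) * Complex.I) * g v) v := by
    intro s v
    by_cases hv : v ∈ Ioi (0 : ℝ)
    · rw [indicator_of_mem hv, indicator_of_mem hv, Circle.smul_def, Real.fourierChar_apply,
        smul_eq_mul]
      congr 2
      push_cast
      have : (Real.pi : ℂ) ≠ 0 := by exact_mod_cast hpi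
      field_simp
    · rw [indicator_of_notMem hv, indicator_of_notMem hv, smul_zero]
  have hRL := Real.tendsto_integral_exp_smul_cocompact ((Ioi (0 : ℝ)).indicator g)
  have hdiv : ∀ c : ℝ, c ≠ 0 → Tendsto (fun τ : ℝ => τ * c) (cocompact ℝ) (cocompact ℝ) :=
    fun c hc => (Homeomorph.mulRight₀ c hc).isClosedEmbedding.tendsto_cocompact
  have hlim : ∀ σ : ℝ, σ ≠ 0 → Tendsto (fun τ : ℝ => ∫ v in Ioi (0 : ℝ),
      Complex.exp (-((σ * τ) * v : ℝ) * Complex.I) * g v) (cocompact ℝ) (𝓝 0) := by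
    intro σ hσ
    refine (hRL.comp (hdiv (σ / (2 * Real.pi)) (by positivity))).congr fun τ => ?_
    rw [← integral_indicator measurableSet_Ioi]
    simp only [Function.comp_apply]
    congr 1
    ext v
    rw [← hexp (σ * τ) v]
    congr 4
    ring
  have hint : ∀ s : ℝ, IntegrableOn (fun v => Complex.exp (-(s * v : ℝ) * Complex.I) * g v)
      (Ioi 0) := fun s => by
    refine hg.norm.mono' ((by fun_prop : Continuous _).aestronglyMeasurable.mul
      hg.aestronglyMeasurable) (Eventually.of_forall fun v => ?_)
    rw [norm_mul, ← Complex.ofReal_neg, Complex.norm_exp_ofReal_mul_I, one_mul]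
  have hsum := (((hlim 1 one_ne_zero).add (hlim (-1) (by norm_num))).div_const 2).const_mul
    (√(2 / Real.pi) : ℂ)
  simp only [add_zero, zero_div, mul_zero] at hsum
  refine hsum.congr fun τ => ?_
  unfold fourierCosine
  rw [← integral_add (hint _) (hint _), ← integral_div]
  congr 2
  ext v
  rw [Complex.ofReal_cos, Complex.cos]
  push_cast
  ring_nf

/-! ### The weighted space -/

/-- The integrability hypotheses satisfied by the elements of the weighted space. -/
def WeightIntegrable (f : ℝ → ℂ) : Prop :=
  AEStronglyMeasurable f (volume.restrict (Ioi 0)) ∧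
    IntegrableOn (fun x => macdonaldWeight x * ‖f x‖) (Ioi 0)

theorem besselK_weight_eq {x : ℝ} (hx : 0 < x) :
    (besselK 0 (√(2 * x) : ℂ)).re ^ 2 = macdonaldWeight x := by
  have : 0 < √(2 * x) := by positivity
  rw [besselK_eq_macdonald _ (by simpa using this), macdonald_zero_ofReal, Complex.ofReal_re]
  rfl

theorem weightMeasure_eq : weightMeasure =
    (volume.restrict (Ioi (0 : ℝ))).withDensity fun x => ENNReal.ofReal (macdonaldWeight x) := by
  unfold weightMeasure
  refine withDensity_congr_ae ?_
  filter_upwards [ae_restrict_mem measurableSet_Ioi] with x hx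
  rw [besselK_weight_eq hx]

theorem aemeasurable_macdonaldWeight :
    AEMeasurable macdonaldWeight (volume.restrict (Ioi (0 : ℝ))) := by
  refine ContinuousOn.aemeasurable ?_ measurableSet_Ioi
  refine (continuousOn_macdonaldReal.comp (by fun_prop) fun x hx => ?_).pow 2
  have : 0 < x := hx
  exact mem_Ioi.2 (by positivity)

/-- The weight is strictly positive. Thus equality in the weighted space is equality almost
everywhere for Lebesgue measure on the half-line, and the transforms do not depend on the
representative. -/
theorem restrict_absolutelyContinuous_weightMeasure :
    volume.restrict (Ioi (0 : ℝ)) ≪ weightMeasure := by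
  rw [weightMeasure_eq]
  refine withDensity_absolutelyContinuous' aemeasurable_macdonaldWeight.ennreal_ofReal ?_
  filter_upwards [ae_restrict_mem measurableSet_Ioi] with x hx
  simpa using macdonaldWeight_pos hx

theorem integrable_weightMeasure_iff {g : ℝ → ℝ} : Integrable g weightMeasure ↔
    IntegrableOn (fun x => macdonaldWeight x * g x) (Ioi 0) := by
  rw [weightMeasure_eq, integrable_withDensity_iff_integrable_smul₀'
    aemeasurable_macdonaldWeight.ennreal_ofReal (by simp)]
  refine integrable_congr ?_
  filter_upwards [ae_restrict_mem measurableSet_Ioi] with x hx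
  rw [ENNReal.toReal_ofReal (macdonaldWeight_pos hx).le, smul_eq_mul]

theorem integral_weightMeasure (g : ℝ → ℝ) :
    ∫ x, g x ∂weightMeasure = ∫ x in Ioi (0 : ℝ), macdonaldWeight x * g x := by
  rw [weightMeasure_eq, integral_withDensity_eq_integral_toReal_smul₀
    aemeasurable_macdonaldWeight.ennreal_ofReal (by simp)]
  refine setIntegral_congr_fun measurableSet_Ioi fun x hx => ?_
  rw [ENNReal.toReal_ofReal (macdonaldWeight_pos hx).le, smul_eq_mul]

theorem weightIntegrable_coe (f : WeightedL1) : WeightIntegrable f :=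
  ⟨(Lp.aestronglyMeasurable f).mono_ac restrict_absolutelyContinuous_weightMeasure,
    integrable_weightMeasure_iff.1 (L1.integrable_coeFn f).norm⟩

theorem norm_weightedL1_eq (f : WeightedL1) :
    ‖f‖ = ∫ x in Ioi (0 : ℝ), macdonaldWeight x * ‖f x‖ := by
  rw [L1.norm_eq_integral_norm, integral_weightMeasure]

/-! ### Fubini and the bounded operator -/

section

variable {f : ℝ → ℂ}

theorem WeightIntegrable.integrableOn_mul (hf : WeightIntegrable f) {k : ℝ → ℂ} {C : ℝ}
    (hk : AEStronglyMeasurable k (volume.restrict (Ioi 0)))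
    (hC : ∀ x, 0 < x → ‖k x‖ ≤ C * macdonaldWeight x) :
    IntegrableOn (fun x => k x * f x) (Ioi 0) := by
  refine (hf.2.const_mul C).mono' (hk.mul hf.1) ?_
  filter_upwards [ae_restrict_mem measurableSet_Ioi] with x hx
  rw [norm_mul, ← mul_assoc]
  exact mul_le_mul_of_nonneg_right (hC x hx) (norm_nonneg _)

theorem WeightIntegrable.integrableOn_indexKernel (hf : WeightIntegrable f) {τ : ℝ} (hτ : τ ≠ 0) :
    IntegrableOn (fun x => indexKernel τ x * f x) (Ioi 0) :=
  hf.integrableOn_mul (aestronglyMeasurable_indexKernel hτ) fun _ hx => norm_indexKernel_le hτ hx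

theorem continuousOn_meijerKernel_right (t : ℝ) :
    ContinuousOn (fun x : ℝ => (meijerKernel (Real.cosh t) x : ℂ)) (Ioi 0) :=
  Complex.continuous_ofReal.comp_continuousOn
    (continuousOn_meijerKernel_cosh.comp (f := fun x : ℝ => (t, x)) (by fun_prop)
      fun _ hx => ⟨mem_univ _, hx⟩)

theorem WeightIntegrable.integrableOn_meijerKernel (hf : WeightIntegrable f) {t : ℝ} (ht : 0 < t) :
    IntegrableOn (fun x => (meijerKernel (Real.cosh t) x : ℂ) * f x) (Ioi 0) :=
  hf.integrableOn_mul (C := t⁻¹)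
    ((continuousOn_meijerKernel_right t).aestronglyMeasurable measurableSet_Ioi) fun x hx => by
      rw [Complex.norm_real, Real.norm_eq_abs, inv_mul_eq_div, le_div_iff₀ ht, mul_comm]
      exact mul_abs_meijerKernel_le_weight hx ht

/-- Tonelli with the `t`-integral taken first: it costs at most the weight at `x`. -/
theorem WeightIntegrable.integrable_prod (hf : WeightIntegrable f) :
    Integrable (fun p : ℝ × ℝ => (meijerKernel (Real.cosh p.1) p.2 : ℂ) * f p.2)
      ((volume.restrict (Ioi 0)).prod (volume.restrict (Ioi 0))) := by
  have hm : AEStronglyMeasurable (fun p : ℝ × ℝ => (meijerKernel (Real.cosh p.1) p.2 : ℂ) * f p.2)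
      ((volume.restrict (Ioi 0)).prod (volume.restrict (Ioi 0))) :=
    (Complex.continuous_ofReal.comp_aestronglyMeasurable
      aestronglyMeasurable_meijerKernel_cosh).mul hf.1.comp_snd
  rw [integrable_prod_iff' hm]
  constructor
  · filter_upwards [ae_restrict_mem measurableSet_Ioi] with x hx
    exact ((integrable_meijerKernel_cosh hx).integrableOn.ofReal).mul_const _
  · refine hf.2.mono' hm.norm.prod_swap.integral_prod_right' ?_
    filter_upwards [ae_restrict_mem measurableSet_Ioi] with x hx
    simp only [norm_mul, Complex.norm_real, Real.norm_eq_abs]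
    rw [integral_mul_const, abs_of_nonneg (mul_nonneg (integral_nonneg fun _ => abs_nonneg _)
      (norm_nonneg _))]
    gcongr
    exact integral_abs_meijerKernel_le hx

theorem WeightIntegrable.integrableOn_meijerTransform (hf : WeightIntegrable f) :
    IntegrableOn (fun t => meijerTransform f (Real.cosh t)) (Ioi 0) :=
  hf.integrable_prod.integral_prod_left.const_mul _

/-- The two factors `√(2/π)` combine to `2/π`. The value `τ = 0` is included, which is what provides
the continuous extension and the uniform bound. -/
theorem WeightIntegrable.fourierCosine_meijerTransform (hf : WeightIntegrable f) (τ : ℝ) :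
    fourierCosine (fun t => meijerTransform f (Real.cosh t)) τ =
      ∫ x in Ioi (0 : ℝ), ((-(2 / Real.pi) * ∫ w in Ioi (0 : ℝ),
        meijerKernel (Real.cosh w) x * Real.cos (τ * w) : ℝ) : ℂ) * f x := by
  have hprod : Integrable (fun p : ℝ × ℝ =>
      (meijerKernel (Real.cosh p.1) p.2 : ℂ) * f p.2 * (Real.cos (τ * p.1) : ℂ))
      ((volume.restrict (Ioi 0)).prod (volume.restrict (Ioi 0))) := by
    refine hf.integrable_prod.norm.mono' (hf.integrable_prod.aestronglyMeasurable.mul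
      (by fun_prop : Continuous fun p : ℝ × ℝ =>
        (Real.cos (τ * p.1) : ℂ)).aestronglyMeasurable) (Eventually.of_forall fun p => ?_)
    rw [norm_mul, Complex.norm_real]
    exact mul_le_of_le_one_right (norm_nonneg _) (Real.abs_cos_le_one _)
  have hswap := integral_integral_swap (f := fun t x : ℝ =>
    (meijerKernel (Real.cosh t) x : ℂ) * f x * (Real.cos (τ * t) : ℂ)) hprod
  have hsq : (√(2 / Real.pi) : ℂ) * (√(2 / Real.pi) : ℂ) = ((2 / Real.pi : ℝ) : ℂ) := by
    rw [← Complex.ofReal_mul, Real.mul_self_sqrt (by positivity)]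
  unfold fourierCosine meijerTransform
  simp only [mul_assoc]
  rw [integral_const_mul, ← mul_assoc, mul_neg, hsq]
  simp only [← integral_mul_const]
  rw [hswap, ← integral_const_mul]
  refine setIntegral_congr_fun measurableSet_Ioi fun x _ => ?_
  rw [Complex.ofReal_mul, ← integral_complex_ofReal, Complex.ofReal_neg, mul_assoc,
    ← integral_mul_const]
  congr 2
  ext w
  push_cast
  ring

theorem WeightIntegrable.fourierCosine_eq_indexTransform (hf : WeightIntegrable f) {τ : ℝ}
    (hτ : τ ≠ 0) :
    fourierCosine (fun t => meijerTransform f (Real.cosh t)) τ = indexTransform f τ := by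
  rw [hf.fourierCosine_meijerTransform τ]
  refine setIntegral_congr_fun measurableSet_Ioi fun x hx => ?_
  rw [indexKernel_eq_integral hτ hx]

theorem WeightIntegrable.norm_fourierCosine_meijerTransform_le (hf : WeightIntegrable f) (τ : ℝ) :
    ‖fourierCosine (fun t => meijerTransform f (Real.cosh t)) τ‖ ≤
      2 / Real.pi * ∫ x in Ioi (0 : ℝ), macdonaldWeight x * ‖f x‖ := by
  rw [hf.fourierCosine_meijerTransform τ, ← integral_const_mul]
  refine norm_integral_le_of_norm_le (hf.2.const_mul _) ?_
  filter_upwards [ae_restrict_mem measurableSet_Ioi] with x hx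
  rw [norm_mul, Complex.norm_real, norm_mul, norm_neg, Real.norm_of_nonneg (by positivity),
    ← mul_assoc]
  gcongr
  refine (norm_integral_le_of_norm_le (integrable_meijerKernel_cosh hx).abs.integrableOn
    (Eventually.of_forall fun w => ?_)).trans (integral_abs_meijerKernel_le hx)
  rw [norm_mul]
  exact mul_le_of_le_one_right (norm_nonneg _) (Real.abs_cos_le_one _)

end

theorem meijerTransform_congr_ae {f g : ℝ → ℂ} (h : f =ᵐ[volume.restrict (Ioi 0)] g) (x : ℝ) :
    meijerTransform f x = meijerTransform g x := by
  unfold meijerTransform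
  congr 1
  refine integral_congr_ae ?_
  filter_upwards [h] with t ht
  rw [ht]

theorem meijerTransform_cosh_add {f g : ℝ → ℂ} (hf : WeightIntegrable f) (hg : WeightIntegrable g)
    {t : ℝ} (ht : 0 < t) : meijerTransform (f + g) (Real.cosh t) =
      meijerTransform f (Real.cosh t) + meijerTransform g (Real.cosh t) := by
  unfold meijerTransform
  rw [← mul_add, ← integral_add (hf.integrableOn_meijerKernel ht) (hg.integrableOn_meijerKernel ht)]
  simp only [Pi.add_apply, mul_add]

theorem meijerTransform_smul (c : ℂ) (f : ℝ → ℂ) (x : ℝ) :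
    meijerTransform (c • f) x = c * meijerTransform f x := by
  unfold meijerTransform
  rw [mul_left_comm, ← integral_const_mul c]
  congr 2
  ext t
  rw [Pi.smul_apply, smul_eq_mul, mul_left_comm]

/-- The index transform as an element of the space of continuous functions vanishing at infinity. -/
noncomputable def indexTransformZeroAtInfty (f : WeightedL1) : C₀(ℝ, ℂ) where
  toFun := fourierCosine fun t => meijerTransform f (Real.cosh t)
  continuous_toFun := continuous_fourierCosine (weightIntegrable_coe f).integrableOn_meijerTransform
  zero_at_infty' :=
    tendsto_fourierCosine_cocompact (weightIntegrable_coe f).integrableOn_meijerTransform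

theorem indexTransformZeroAtInfty_apply (f : WeightedL1) (τ : ℝ) :
    indexTransformZeroAtInfty f τ = fourierCosine (fun t => meijerTransform f (Real.cosh t)) τ :=
  rfl

theorem indexTransformZeroAtInfty_add (f g : WeightedL1) : indexTransformZeroAtInfty (f + g) =
    indexTransformZeroAtInfty f + indexTransformZeroAtInfty g := by
  ext τ
  have hf := weightIntegrable_coe f
  have hg := weightIntegrable_coe g
  have hae := restrict_absolutelyContinuous_weightMeasure.ae_eq (Lp.coeFn_add f g)
  simp only [ZeroAtInftyContinuousMap.add_apply, indexTransformZeroAtInfty_apply]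
  unfold fourierCosine
  rw [← mul_add, ← integral_add (integrableOn_mul_cos hf.integrableOn_meijerTransform τ)
    (integrableOn_mul_cos hg.integrableOn_meijerTransform τ)]
  congr 1
  refine setIntegral_congr_fun measurableSet_Ioi fun t ht => ?_
  simp only
  rw [meijerTransform_congr_ae hae, meijerTransform_cosh_add hf hg ht, add_mul]

theorem indexTransformZeroAtInfty_smul (c : ℂ) (f : WeightedL1) :
    indexTransformZeroAtInfty (c • f) = c • indexTransformZeroAtInfty f := by
  ext τ
  have hae := restrict_absolutelyContinuous_weightMeasure.ae_eq (Lp.coeFn_smul c f)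
  simp only [ZeroAtInftyContinuousMap.smul_apply, indexTransformZeroAtInfty_apply]
  unfold fourierCosine
  simp only [meijerTransform_congr_ae hae, meijerTransform_smul, smul_eq_mul]
  rw [mul_left_comm, ← integral_const_mul c]
  simp only [mul_assoc]

theorem norm_indexTransformZeroAtInfty_le (f : WeightedL1) :
    ‖indexTransformZeroAtInfty f‖ ≤ 4 / Real.pi * ‖f‖ := by
  rw [← ZeroAtInftyContinuousMap.norm_toBCF_eq_norm,
    BoundedContinuousFunction.norm_le (by positivity)]
  intro τ
  refine ((weightIntegrable_coe f).norm_fourierCosine_meijerTransform_le τ).trans ?_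
  rw [norm_weightedL1_eq]
  have h0 : 0 ≤ ∫ x in Ioi (0 : ℝ), macdonaldWeight x * ‖f x‖ :=
    setIntegral_nonneg measurableSet_Ioi fun x hx =>
      mul_nonneg (macdonaldWeight_pos hx).le (norm_nonneg _)
  gcongr
  -- The estimate holds with `2/π`; it is only here weakened to `4/π`.
  norm_num

/-- The index transform as a bounded linear operator. -/
noncomputable def indexTransformCLM : WeightedL1 →L[ℂ] C₀(ℝ, ℂ) :=
  LinearMap.mkContinuous
    { toFun := indexTransformZeroAtInfty
      map_add' := indexTransformZeroAtInfty_add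
      map_smul' := indexTransformZeroAtInfty_smul }
    (4 / Real.pi) norm_indexTransformZeroAtInfty_le

theorem theorem1 :
    ∃ T : WeightedL1 →L[ℂ] C₀(ℝ, ℂ),
      ‖T‖ ≤ 4 / Real.pi ∧
      (∀ f : WeightedL1,
        (∀ τ : ℝ, τ ≠ 0 →
          IntegrableOn (fun x => indexKernel τ x * f x) (Ioi 0) ∧
            T f τ = indexTransform f τ) ∧
        (∀ t : ℝ, 0 < t →
          IntegrableOn (fun x => (meijerKernel (Real.cosh t) x : ℂ) * f x) (Ioi 0)) ∧
        IntegrableOn (fun t => meijerTransform f (Real.cosh t)) (Ioi 0) ∧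
        ∀ τ : ℝ, T f τ = fourierCosine (fun t => meijerTransform f (Real.cosh t)) τ) := by
  refine ⟨indexTransformCLM, LinearMap.mkContinuous_norm_le _ (by positivity) _, fun f => ?_⟩
  have hf := weightIntegrable_coe f
  exact ⟨fun τ hτ => ⟨hf.integrableOn_indexKernel hτ, hf.fourierCosine_eq_indexTransform hτ⟩,
    fun t ht => hf.integrableOn_meijerKernel ht, hf.integrableOn_meijerTransform, fun τ => rfl⟩
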